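/- Let $p$ be a prime. A \emph{discrete $p$-toral group} is a group $S$ with a normal subgroup $T\cong(\mathbb{Z}/p^\infty)^r$, $r\ge 0$ finite, such that $S/T$ is a finite $p$-group; then $T$ is unique, every subgroup of $S$ is again discrete $p$-toral, and the \emph{order} of $S$ is the pair $|S|=(r,|S/T|)$, such pairs being compared lexicographically. A \emph{fusion system} $\mathcal{F}$ over $S$ is a category whose objects are the subgroups of $S$, whose morphism sets $\operatorname{Hom}_{\mathcal F}(P,Q)$ consist of injective homomorphisms $P\to Q$ (with composition of maps) and contain all those induced by conjugation by elements of $S$, and in which every morphism is an isomorphism of $\mathcal F$ followed by an inclusion. Subgroups (elements $x,y$) are \emph{$\mathcal F$-conjugate} if they are isomorphic in $\mathcal F$ (if some $\varphi\in\operatorname{Hom}_{\mathcal F}(\langle x\rangle,\langle y\rangle)$ has $\varphi(x)=y$). A subgroup $P\le S$ is \emph{fully centralized} (\emph{fully normalized}) in $\mathcal F$ if $|C_S(P)|\ge|C_S(Q)|$ (respectively $|N_S(P)|\ge|N_S(Q)|$) for all $Q$ that are $\mathcal F$-conjugate to $P$. Write $\operatorname{Aut}_S(P)$ for the group of automorphisms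 of $P$ induced by conjugation by elements of $N_S(P)$, $\operatorname{Out}_S(P)=\operatorname{Aut}_S(P)/\operatorname{Inn}(P)$ and $\operatorname{Out}_{\mathcal F}(P)=\operatorname{Aut}_{\mathcal F}(P)/\operatorname{Inn}(P)$. The fusion system $\mathcal F$ is \emph{saturated} if: (I) every $P\le S$ that is fully normalized in $\mathcal F$ is fully centralized in $\mathcal F$, $\operatorname{Out}_{\mathcal F}(P)$ is finite, and $\operatorname{Out}_S(P)$ is a Sylow $p$-subgroup of $\operatorname{Out}_{\mathcal F}(P)$; (II) if $P\le S$ and $\varphi\in\operatorname{Hom}_{\mathcal F}(P,S)$ are such that $\varphi(P)$ is fully centralized, then $\varphi$ extends to a morphism in $\operatorname{Hom}_{\mathcal F}(N_\varphi,S)$, where $N_\varphi=\{g\in N_S(P)\mid \varphi c_g\varphi^{-1}\in\operatorname{Aut}_S(\varphi(P))\}$; (III) if $P_1\le P_2\le\cdots$ are subgroups of $S$ with union $P_\infty$, and $\varphi\colon P_\infty\to S$ is a homomorphism with $\varphi|_{P_n}\in\operatorname{Hom}_{\mathcal F}(P_n,S)$ for all $n$, then $\varphi\in\operatorname{Hom}_{\mathcal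 F}(P_\infty,S)$. For $x\in S$, the \emph{centralizer fusion system} $C_{\mathcal F}(x)$ over $C_S(x)$ has as morphisms $P\to Q$, for $P,Q\le C_S(x)$, the homomorphisms that extend to a morphism $P\langle x\rangle\to Q\langle x\rangle$ of $\mathcal F$ sending $x$ to $x$. \textbf{Proposition.} Let $\mathcal F$ be a fusion system over a discrete $p$-toral group $S$. Then $\mathcal F$ is saturated if and only if the following two conditions hold. (a) $\mathcal F$ satisfies axiom (III). (b) There is a set $\mathfrak X$ of elements of order $p$ in $S$ such that (i) each $x\in S$ of order $p$ is $\mathcal F$-conjugate to some $y\in\mathfrak X$; (ii) if $x,y\in S$ are $\mathcal F$-conjugate and $y\in\mathfrak X$, then there is $\rho\in\operatorname{Hom}_{\mathcal F}(C_S(x),C_S(y))$ with $\rho(x)=y$; and (iii) for each $x\in\mathfrak X$, $C_{\mathcal F}(x)$ is a saturated fusion system over $C_S(x)$. -/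

import Mathlib

/-- The quasicyclic group `ℤ/p^∞`, realized as the group of complex roots of unity of
`p`-power order. -/
abbrev PruferGroup (p : ℕ) : Type := CommGroup.primaryComponent Circle p

/-- A discrete `p`-toral group: a group with a normal subgroup `T ≅ (ℤ/p^∞)^r`, for some finite
`r ≥ 0`, such that the quotient by `T` is a finite `p`-group. -/
def IsDiscretePToral (p : ℕ) (G : Type*) [Group G] : Prop :=
  ∃ (T : Subgroup G) (_ : T.Normal) (r : ℕ),
    Nonempty (T ≃* (Fin r → PruferGroup p)) ∧ Finite (G ⧸ T) ∧ IsPGroup p (G ⧸ T)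

/-- The identity component of a discrete `p`-toral group: its smallest subgroup of finite index.
If `T` is as in the definition of a discrete `p`-toral group, this is `T`. -/
def identityComponent (G : Type*) [Group G] : Subgroup G :=
  sInf {H : Subgroup G | H.FiniteIndex}

/-- The rank of a discrete `p`-toral group: the (unique) `r` such that the identity component is
isomorphic to `(ℤ/p^∞)^r`. -/
noncomputable def toralRank (p : ℕ) (G : Type*) [Group G] : ℕ :=
  sInf {r : ℕ | Nonempty (identityComponent G ≃* (Fin r → PruferGroup p))}

/-- The order of a discrete `p`-toral group: the pair formed by the rank and the number of
components, in the lexicographic order. -/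
noncomputable def toralOrder (p : ℕ) (G : Type*) [Group G] : ℕ ×ₗ ℕ :=
  toLex (toralRank p G, (identityComponent G).index)

/-- A fusion system over `S`: a category whose objects are the subgroups of `S` and whose morphism
sets are sets of injective homomorphisms (composed as maps), which contain all the homomorphisms
induced by conjugation in `S` (in particular identities and inclusions), and such that each
morphism is an isomorphism of the category followed by an inclusion. -/
structure FusionSystem (S : Type*) [Group S] where
  Hom : (P Q : Subgroup S) → Set (P →* Q)
  injective_of_mem : ∀ {P Q : Subgroup S} {φ : P →* Q}, φ ∈ Hom P Q → Function.Injective φ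
  conj_mem : ∀ {P Q : Subgroup S} (φ : P →* Q),
    (∃ g : S, ∀ x : P, (φ x : S) = g * x * g⁻¹) → φ ∈ Hom P Q
  comp_mem : ∀ {P Q R : Subgroup S} {φ : P →* Q} {ψ : Q →* R},
    φ ∈ Hom P Q → ψ ∈ Hom Q R → ψ.comp φ ∈ Hom P R
  factor : ∀ {P Q : Subgroup S} {φ : P →* Q}, φ ∈ Hom P Q →
    ∃ (R : Subgroup S) (hR : R ≤ Q) (e : P ≃* R),
      e.toMonoidHom ∈ Hom P R ∧ e.symm.toMonoidHom ∈ Hom R P ∧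
        φ = (Subgroup.inclusion hR).comp e.toMonoidHom

/-- The image in `S` of a homomorphism between subgroups of `S`. -/
def homImage {S : Type*} [Group S] {P Q : Subgroup S} (φ : P →* Q) : Subgroup S :=
  φ.range.map Q.subtype

/-- The group `Inn(G)` of inner automorphisms. -/
def innerAut (G : Type*) [Group G] : Subgroup (MulAut G) :=
  (MulAut.conj : G →* MulAut G).range

instance innerAut_normal (G : Type*) [Group G] : (innerAut G).Normal := by
  constructor
  rintro _ ⟨g, rfl⟩ α
  refine ⟨α g, ?_⟩
  ext x
  simp [MulAut.conj_apply]

/-- The group `Out(G) = Aut(G) / Inn(G)`. -/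
abbrev OuterAut (G : Type*) [Group G] : Type _ := MulAut G ⧸ innerAut G

/-- `Aut_S(P)`: the automorphisms of `P` induced by conjugation by elements of `N_S(P)`. -/
def autBy {S : Type*} [Group S] (P : Subgroup S) : Subgroup (MulAut P) :=
  P.normalizerMonoidHom.range

/-- `Out_S(P) = Aut_S(P) / Inn(P)`, as a subgroup of `Out(P)`. -/
def outBy {S : Type*} [Group S] (P : Subgroup S) : Subgroup (OuterAut P) :=
  (autBy P).map (QuotientGroup.mk' (innerAut P))

/-- For `φ : P → S`, the subgroup `N_φ` of those `g ∈ N_S(P)` such that `φ ∘ c_g ∘ φ⁻¹` is the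
automorphism `c_h` of `φ(P)` for some `h ∈ N_S(φ(P))`. -/
def extensionDomain {S : Type*} [Group S] {P : Subgroup S} (φ : P →* (⊤ : Subgroup S)) :
    Subgroup S where
  carrier := {g | g ∈ Subgroup.normalizer (P : Set S) ∧
    ∃ h ∈ Subgroup.normalizer (homImage φ : Set S),
      ∀ x y : P, (y : S) = g * x * g⁻¹ → (φ y : S) = h * φ x * h⁻¹}
  one_mem' := by
    refine ⟨one_mem _, 1, one_mem _, fun x y hxy => ?_⟩
    have : y = x := Subtype.ext (by simpa using hxy)
    simp [this]
  mul_mem' := by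
    rintro a b ⟨ha, h, hh, Ha⟩ ⟨hb, k, hk, Hb⟩
    refine ⟨mul_mem ha hb, h * k, mul_mem hh hk, fun x y hxy => ?_⟩
    have hz : b * x * b⁻¹ ∈ P := (hb x).1 x.2
    rw [Ha ⟨_, hz⟩ y (by simp [hxy, mul_assoc]), Hb x ⟨_, hz⟩ rfl]
    simp [mul_assoc]
  inv_mem' := by
    rintro a ⟨ha, h, hh, Ha⟩
    refine ⟨inv_mem ha, h⁻¹, inv_mem hh, fun x y hxy => ?_⟩
    rw [Ha y x (by simp [hxy, mul_assoc])]
    simp [mul_assoc]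

theorem le_extensionDomain {S : Type*} [Group S] {P : Subgroup S}
    (φ : P →* (⊤ : Subgroup S)) : P ≤ extensionDomain φ := by
  intro g hg
  refine ⟨Subgroup.le_normalizer hg, φ ⟨g, hg⟩, Subgroup.le_normalizer ?_, fun x y hxy => ?_⟩
  · exact ⟨φ ⟨g, hg⟩, ⟨_, rfl⟩, rfl⟩
  · have : y = ⟨g, hg⟩ * x * (⟨g, hg⟩ : P)⁻¹ := Subtype.ext (by simpa using hxy)
    simp [this]

namespace FusionSystem

/-- `P` and `Q` are `F`-conjugate: they are isomorphic in the category `F`. -/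
def IsConjugate {S : Type*} [Group S] (F : FusionSystem S) (P Q : Subgroup S) : Prop :=
  ∃ e : P ≃* Q, e.toMonoidHom ∈ F.Hom P Q ∧ e.symm.toMonoidHom ∈ F.Hom Q P

/-- The elements `x` and `y` are `F`-conjugate: some morphism `⟨x⟩ → ⟨y⟩` in `F` sends
`x` to `y`. -/
def IsConjugateElement {S : Type*} [Group S] (F : FusionSystem S) (x y : S) : Prop :=
  ∃ φ ∈ F.Hom (Subgroup.zpowers x) (Subgroup.zpowers y),
    (φ ⟨x, Subgroup.mem_zpowers x⟩ : S) = y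

/-- `|C_S(P)| ≥ |C_S(Q)|` for all `Q` that are `F`-conjugate to `P`. -/
def FullyCentralized {S : Type*} [Group S] (p : ℕ) (F : FusionSystem S) (P : Subgroup S) : Prop :=
  ∀ Q : Subgroup S, F.IsConjugate P Q →
    toralOrder p (Subgroup.centralizer (Q : Set S)) ≤
      toralOrder p (Subgroup.centralizer (P : Set S))

/-- `|N_S(P)| ≥ |N_S(Q)|` for all `Q` that are `F`-conjugate to `P`. -/
def FullyNormalized {S : Type*} [Group S] (p : ℕ) (F : FusionSystem S) (P : Subgroup S) : Prop :=
  ∀ Q : Subgroup S, F.IsConjugate P Q →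
    toralOrder p (Subgroup.normalizer (Q : Set S)) ≤
      toralOrder p (Subgroup.normalizer (P : Set S))

theorem id_mem {S : Type*} [Group S] (F : FusionSystem S) (P : Subgroup S) :
    MonoidHom.id P ∈ F.Hom P P :=
  F.conj_mem _ ⟨1, fun x => by simp⟩

/-- `Aut_F(P)`: the automorphisms of `P` in the category `F`. -/
def aut {S : Type*} [Group S] (F : FusionSystem S) (P : Subgroup S) : Subgroup (MulAut P) where
  carrier := {α | MulEquiv.toMonoidHom α ∈ F.Hom P P ∧
    MulEquiv.toMonoidHom (MulEquiv.symm α) ∈ F.Hom P P}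
  one_mem' := ⟨F.id_mem P, F.id_mem P⟩
  mul_mem' := fun ha hb => ⟨F.comp_mem hb.1 ha.1, F.comp_mem ha.2 hb.2⟩
  inv_mem' := fun ha => ⟨ha.2, ha.1⟩

/-- `Out_F(P) = Aut_F(P) / Inn(P)`, as a subgroup of `Out(P)`. -/
def out {S : Type*} [Group S] (F : FusionSystem S) (P : Subgroup S) : Subgroup (OuterAut P) :=
  (F.aut P).map (QuotientGroup.mk' (innerAut P))

/-- Axiom (I): a fully normalized subgroup `P` is fully centralized, `Out_F(P)` is finite, and
`Out_S(P)` is a Sylow `p`-subgroup of `Out_F(P)`. -/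
def SylowAxiom {S : Type*} [Group S] (p : ℕ) (F : FusionSystem S) : Prop :=
  ∀ P : Subgroup S, F.FullyNormalized p P →
    F.FullyCentralized p P ∧ Finite (F.out P) ∧
      ∃ R : Sylow p (F.out P), (R : Subgroup (F.out P)) = (outBy P).subgroupOf (F.out P)

/-- Axiom (II): a morphism `φ : P → S` with fully centralized image extends to `N_φ`. -/
def ExtensionAxiom {S : Type*} [Group S] (p : ℕ) (F : FusionSystem S) : Prop :=
  ∀ (P : Subgroup S), ∀ φ ∈ F.Hom P ⊤, F.FullyCentralized p (homImage φ) →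
    ∃ ψ ∈ F.Hom (extensionDomain φ) ⊤,
      ψ.comp (Subgroup.inclusion (le_extensionDomain φ)) = φ

/-- Axiom (III): a homomorphism to `S` from the union of an increasing sequence of subgroups is in
`F` if its restriction to each of these subgroups is. -/
def ContinuityAxiom {S : Type*} [Group S] (F : FusionSystem S) : Prop :=
  ∀ (P : ℕ → Subgroup S), Monotone P → ∀ φ : (⨆ n, P n : Subgroup S) →* (⊤ : Subgroup S),
    (∀ n, φ.comp (Subgroup.inclusion (le_iSup P n)) ∈ F.Hom (P n) ⊤) →
      φ ∈ F.Hom (⨆ n, P n) ⊤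

/-- A saturated fusion system over a discrete `p`-toral group `S`. -/
structure IsSaturated {S : Type*} [Group S] (p : ℕ) (F : FusionSystem S) : Prop where
  sylowAxiom : F.SylowAxiom p
  extensionAxiom : F.ExtensionAxiom p
  continuityAxiom : F.ContinuityAxiom

end FusionSystem

/-- The centralizer `C_S(x)`. -/
abbrev elemCentralizer {S : Type*} [Group S] (x : S) : Subgroup S := Subgroup.centralizer {x}

theorem mem_elemCentralizer_self {S : Type*} [Group S] (x : S) : x ∈ elemCentralizer x :=
  Subgroup.mem_centralizer_singleton_iff.2 rfl

/-- For `P ≤ C_S(x)`, the subgroup `P⟨x⟩` of `S`. -/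
def joinElem {S : Type*} [Group S] {x : S} (P : Subgroup (elemCentralizer x)) : Subgroup S :=
  P.map (elemCentralizer x).subtype ⊔ Subgroup.zpowers x

theorem elem_mem_joinElem {S : Type*} [Group S] {x : S} (P : Subgroup (elemCentralizer x)) :
    x ∈ joinElem P :=
  (le_sup_right : Subgroup.zpowers x ≤ joinElem P) (Subgroup.mem_zpowers x)

theorem coe_mem_joinElem {S : Type*} [Group S] {x : S} {P : Subgroup (elemCentralizer x)}
    (a : P) : ((a : elemCentralizer x) : S) ∈ joinElem P :=
  (le_sup_left : P.map (elemCentralizer x).subtype ≤ joinElem P) ⟨a, a.2, rfl⟩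

namespace FusionSystem

/-- The centralizer fusion system `C_F(x)` over `C_S(x)`: for `P, Q ≤ C_S(x)`, its morphisms
`P → Q` are the homomorphisms that extend to a morphism `P⟨x⟩ → Q⟨x⟩` of `F` sending `x`
to `x`. -/
def centralizer {S : Type*} [Group S] (F : FusionSystem S) (x : S) :
    FusionSystem (elemCentralizer x) where
  Hom P Q := {φ | ∃ ψ ∈ F.Hom (joinElem P) (joinElem Q),
    (ψ ⟨x, elem_mem_joinElem P⟩ : S) = x ∧
      ∀ a : P, (ψ ⟨a, coe_mem_joinElem a⟩ : S) = (φ a : elemCentralizer x)}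
  injective_of_mem := by
    rintro P Q φ ⟨ψ, hψ, -, h⟩ a b hab
    have h1 : ψ ⟨a, coe_mem_joinElem a⟩ = ψ ⟨b, coe_mem_joinElem b⟩ :=
      Subtype.ext (by rw [h, h, hab])
    have h2 := F.injective_of_mem hψ h1
    exact Subtype.ext (Subtype.ext (Subtype.mk.inj h2))
  conj_mem := by
    rintro P Q φ ⟨g, hg⟩
    have hgx : (g : S) * x * (g : S)⁻¹ = x := by
      have := Subgroup.mem_centralizer_singleton_iff.1 g.2
      rw [mul_inv_eq_iff_eq_mul]
      exact this
    have hle : joinElem P ≤ (joinElem Q).comap (MulAut.conj (g : S)).toMonoidHom := by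
      refine sup_le ?_ ?_
      · rintro _ ⟨a, ha, rfl⟩
        have := coe_mem_joinElem (φ ⟨a, ha⟩)
        rw [hg] at this
        simpa using this
      · rw [Subgroup.zpowers_le]
        simpa [hgx] using elem_mem_joinElem Q
    refine ⟨((MulAut.conj (g : S)).toMonoidHom.comp (joinElem P).subtype).codRestrict _
      (fun a => hle a.2), F.conj_mem _ ⟨g, fun a => rfl⟩, by simpa using hgx, fun a => ?_⟩
    simp [hg]
  comp_mem := by
    rintro P Q R φ φ' ⟨ψ, hψ, hx, h⟩ ⟨ψ', hψ', hx', h'⟩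
    refine ⟨ψ'.comp ψ, F.comp_mem hψ hψ', ?_, fun a => ?_⟩
    · have : ψ ⟨x, elem_mem_joinElem P⟩ = ⟨x, elem_mem_joinElem Q⟩ := Subtype.ext hx
      simp [this, hx']
    · have : ψ ⟨a, coe_mem_joinElem a⟩ = ⟨φ a, coe_mem_joinElem (φ a)⟩ := Subtype.ext (h a)
      simp [this, h']
  factor := by
    rintro P Q φ ⟨ψ, hψ, hx, h⟩
    have hinj : Function.Injective φ := by
      intro a b hab
      have h1 : ψ ⟨a, coe_mem_joinElem a⟩ = ψ ⟨b, coe_mem_joinElem b⟩ :=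
        Subtype.ext (by rw [h, h, hab])
      have h2 := F.injective_of_mem hψ h1
      exact Subtype.ext (Subtype.ext (Subtype.mk.inj h2))
    obtain ⟨R', hR', e', he', he'', rfl⟩ := F.factor hψ
    let R : Subgroup (elemCentralizer x) := homImage φ
    have hR : R ≤ Q := by
      rintro _ ⟨b, -, rfl⟩
      exact b.2
    let e : P ≃* R := (MonoidHom.ofInjective hinj).trans
      (φ.range.equivMapOfInjective Q.subtype Q.subtype_injective)
    have he : ∀ a : P, ((e a : elemCentralizer x)) = φ a := fun a => rfl
    have hRR : R' = joinElem R := by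
      have hR1 : R' = (R'.subtype.comp e'.toMonoidHom).range := by
        have htop : e'.toMonoidHom.range = ⊤ := MonoidHom.range_eq_top.2 e'.surjective
        rw [MonoidHom.range_comp, htop, ← MonoidHom.range_eq_map, Subgroup.range_subtype]
      apply le_antisymm
      · have key : joinElem P ≤ ((joinElem R).comap
            (R'.subtype.comp e'.toMonoidHom)).map (joinElem P).subtype := by
          refine sup_le ?_ ?_
          · rintro _ ⟨a, ha, rfl⟩
            refine ⟨⟨a, coe_mem_joinElem ⟨a, ha⟩⟩, ?_, rfl⟩
            have h1 := h ⟨a, ha⟩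
            have h2 := coe_mem_joinElem (e ⟨a, ha⟩)
            rw [he, ← h1] at h2
            exact h2
          · rw [Subgroup.zpowers_le]
            refine ⟨⟨x, elem_mem_joinElem P⟩, ?_, rfl⟩
            have h2 := elem_mem_joinElem R
            have h3 : ((e' ⟨x, elem_mem_joinElem P⟩ : R') : S) = x := hx
            change ((e' ⟨x, elem_mem_joinElem P⟩ : R') : S) ∈ joinElem R
            rw [h3]
            exact h2
        rw [hR1]
        rintro _ ⟨a, rfl⟩
        obtain ⟨b, hb, hba⟩ := key a.2
        have : b = a := Subtype.ext hba
        rw [← this]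
        exact hb
      · refine sup_le ?_ ?_
        · rintro _ ⟨b, hb, rfl⟩
          obtain ⟨a, ha⟩ := e.surjective ⟨b, hb⟩
          have h1 := h a
          rw [← he, ha] at h1
          change (b : S) ∈ R'
          rw [← h1]
          exact (e' _).2
        · rw [Subgroup.zpowers_le]
          have h3 : ((e' ⟨x, elem_mem_joinElem P⟩ : R') : S) = x := hx
          rw [← h3]
          exact (e' _).2
    subst hRR
    have hx' : e' ⟨x, elem_mem_joinElem P⟩ = ⟨x, elem_mem_joinElem R⟩ := Subtype.ext hx
    have h' : ∀ a : P, e' ⟨a, coe_mem_joinElem a⟩ = ⟨e a, coe_mem_joinElem (e a)⟩ :=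
      fun a => Subtype.ext (h a)
    refine ⟨R, hR, e, ⟨e'.toMonoidHom, he', hx, h⟩, ⟨e'.symm.toMonoidHom, he'', ?_, ?_⟩, rfl⟩
    · change ((e'.symm ⟨x, elem_mem_joinElem R⟩ : joinElem P) : S) = x
      rw [← hx', e'.symm_apply_apply]
    · intro b
      obtain ⟨a, rfl⟩ := e.surjective b
      change ((e'.symm ⟨e a, coe_mem_joinElem (e a)⟩ : joinElem P) : S) = ((e.symm (e a) : P) : _)
      rw [← h', e'.symm_apply_apply, e.symm_apply_apply]

end FusionSystem

/-!
A fully centralized `⟨x⟩` has a receptive generator by the extension axiom, and the centralizer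
system of a receptive element of a saturated system is saturated: restriction to `P` identifies
`Aut_{C_F(x)}(P)` with the stabilizer of `x` in `Aut_F(P⟨x⟩)`, so the image of `P⟨x⟩` under a
suitable isomorphism has a Sylow group of automorphisms inside the centralizer system too.

Conversely, in a nontrivial discrete `p`-toral group `P` the elements of order dividing `p` of the
center fixed by `Aut_S(P)` contain one, `x`, of order `p` whose stabilizer has index prime to `p` in
`Aut_F(P)`. Then `N_S(P) ≤ C_S(x)`, and `Aut_S(P)` is Sylow in `Aut_F(P)` as soon as it is Sylow in
the stabilizer of `x`, that is in `Aut_{C_F(x)}(P)`. Moving `x` to a receptive element `y` with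
saturated centralizer system transfers the Sylow and extension axioms from `C_F(y)` to `F`.
-/

/-! ### Divisible `p`-groups -/

open scoped IsMulCommutative

/-- The `n`-torsion `{a | a ^ n = 1}` of a monoid. It is only a set because the monoid need not be
commutative. -/
def torsionSet (n : ℕ) (M : Type*) [Monoid M] : Set M := {a | a ^ n = 1}

section Torsion

variable {M N : Type*} {n : ℕ}

theorem mapsTo_torsionSet [Monoid M] [Monoid N] (f : M →* N) (n : ℕ) :
    Set.MapsTo f (torsionSet n M) (torsionSet n N) := fun a ha => by
  change f a ^ n = 1
  rw [← map_pow, show a ^ n = 1 from ha, map_one]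

theorem finite_torsionSet_of_injective [Monoid M] [Monoid N] {f : M →* N}
    (hf : Function.Injective f) (h : (torsionSet n N).Finite) : (torsionSet n M).Finite :=
  h.of_injOn (mapsTo_torsionSet f n) hf.injOn

theorem ncard_torsionSet_congr [Monoid M] [Monoid N] (e : M ≃* N) (n : ℕ) :
    (torsionSet n M).ncard = (torsionSet n N).ncard := by
  refine Nat.card_congr (e.toEquiv.subtypeEquiv fun a => ?_)
  change a ^ n = 1 ↔ e a ^ n = 1
  rw [← map_pow, map_eq_one_iff _ e.injective]

theorem ncard_torsionSet_pi {ι : Type*} [Finite ι] (n : ℕ) (M : Type*) [Monoid M] :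
    (torsionSet n (ι → M)).ncard = (torsionSet n M).ncard ^ Nat.card ι :=
  calc (torsionSet n (ι → M)).ncard = Nat.card (ι → torsionSet n M) :=
        Nat.card_congr <| (Equiv.subtypeEquivRight fun _ => funext_iff).trans
          (Equiv.subtypePiEquivPi (p := fun _ a => a ^ n = 1))
    _ = (torsionSet n M).ncard ^ Nat.card ι := Nat.card_fun

theorem finite_setOf_pow_eq [CommGroup M] (h : (torsionSet n M).Finite) (c : M) :
    {a : M | a ^ n = c}.Finite := by
  by_cases hc : ∃ b : M, b ^ n = c
  · obtain ⟨b, rfl⟩ := hc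
    refine (h.image (· * b)).subset fun a (ha : a ^ n = b ^ n) => ⟨a * b⁻¹, ?_, by simp⟩
    change (a * b⁻¹) ^ n = 1
    rw [mul_pow, ha, inv_pow, mul_inv_cancel]
  · exact Set.finite_empty.subset fun a ha => hc ⟨a, ha⟩

theorem finite_torsionSet_pow [CommGroup M] (h : (torsionSet n M).Finite) (k : ℕ) :
    (torsionSet (n ^ k) M).Finite := by
  induction k with
  | zero => simp [torsionSet]
  | succ k ih =>
    refine (ih.preimage' (f := (· ^ n)) fun c _ => finite_setOf_pow_eq h c).subset fun a ha => ?_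
    change (a ^ n) ^ n ^ k = 1
    rw [← pow_mul, ← pow_succ']
    exact ha

theorem surjective_pow_pow [Monoid M] (h : Function.Surjective fun a : M => a ^ n) (k : ℕ) :
    Function.Surjective fun a : M => a ^ n ^ k := by
  simpa only [pow_iterate] using h.iterate k

theorem nonempty_mulEquiv_of_forall_pow_prime_eq_one {p : ℕ} [Fact p.Prime] [CommGroup M]
    [CommGroup N] (hM : ∀ a : M, a ^ p = 1) (hN : ∀ b : N, b ^ p = 1) [Finite M]
    [Finite N] (h : Nat.card M = Nat.card N) : Nonempty (M ≃* N) := by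
  let : Module (ZMod p) (Additive M) := AddCommGroup.zmodModule (n := p) hM
  let : Module (ZMod p) (Additive N) := AddCommGroup.zmodModule (n := p) hN
  have hcard : p ^ Module.finrank (ZMod p) (Additive M) =
      p ^ Module.finrank (ZMod p) (Additive N) := by
    have hM' := Module.natCard_eq_pow_finrank (K := ZMod p) (V := Additive M)
    have hN' := Module.natCard_eq_pow_finrank (K := ZMod p) (V := Additive N)
    rw [Nat.card_zmod] at hM' hN'
    rw [← hM', ← hN']
    exact h
  have hrank := Nat.pow_right_injective (Fact.out : p.Prime).two_le hcard
  exact ⟨MulEquiv.toAdditive.symm (LinearEquiv.ofFinrankEq _ _ hrank).toAddEquiv⟩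

end Torsion

section PGroup

variable {p : ℕ} {G H : Type*} [Group G] [Group H]

theorem isPGroup_induction (hG : IsPGroup p G) {motive : G → Prop} (one : motive 1)
    (of_pow : ∀ g, motive (g ^ p) → motive g) (g : G) : motive g := by
  obtain ⟨k, hk⟩ := hG g
  induction k generalizing g with
  | zero =>
    rw [pow_zero, pow_one] at hk
    rwa [hk]
  | succ k ih => exact of_pow g (ih (g ^ p) (by rw [← pow_mul, ← pow_succ', hk]))

theorem injective_of_torsionSet (hH : IsPGroup p H) (f : H →* G)
    (hf : ∀ h ∈ torsionSet p H, f h = 1 → h = 1) : Function.Injective f :=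
  (injective_iff_map_eq_one f).2 <| isPGroup_induction hH (fun _ => rfl) fun h ih h1 =>
    hf h (ih (by rw [map_pow, h1, one_pow])) h1

theorem surjective_of_torsionSet_subset_range [IsMulCommutative G] (hG : IsPGroup p G)
    (hdiv : Function.Surjective fun a : H => a ^ p) (f : H →* G)
    (hf : torsionSet p G ⊆ Set.range f) : Function.Surjective f := by
  refine isPGroup_induction hG ⟨1, map_one f⟩ ?_
  rintro g ⟨h, hh⟩
  obtain ⟨a, rfl⟩ := hdiv h
  obtain ⟨b, hb⟩ : g * (f a)⁻¹ ∈ Set.range f := hf <| by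
    change (g * (f a)⁻¹) ^ p = 1
    rw [mul_pow, inv_pow, ← map_pow, hh, mul_inv_cancel]
  exact ⟨b * a, by rw [map_mul, hb, inv_mul_cancel_right]⟩

theorem surjective_pow_of_ne_zero [Fact p.Prime] (hG : IsPGroup p G)
    (hdiv : Function.Surjective fun a : G => a ^ p) {n : ℕ} (hn : n ≠ 0) :
    Function.Surjective fun a : G => a ^ n := by
  obtain ⟨k, m, hm, rfl⟩ := Nat.exists_eq_pow_mul_and_not_dvd hn p (Fact.out : p.Prime).ne_one
  have hm' : Function.Surjective fun a : G => a ^ m :=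
    (hG.powEquiv ((Nat.Prime.coprime_iff_not_dvd Fact.out).2 hm)).surjective
  simpa only [Function.comp_def, ← pow_mul] using hm'.comp (surjective_pow_pow hdiv k)

theorem exists_comp_eq_of_injective_of_divisible [Fact p.Prime] {A B D : Type*} [CommGroup A]
    [CommGroup B] [CommGroup D] (hD : IsPGroup p D)
    (hdiv : Function.Surjective fun a : D => a ^ p) {i : A →* B} (hi : Function.Injective i)
    (f : A →* D) : ∃ g : B →* D, g.comp i = f := by
  let : RootableBy D ℕ := rootableByOfPowLeftSurj D ℕ (surjective_pow_of_ne_zero hD hdiv)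
  let : RootableBy D ℤ := Group.rootableByIntOfRootableByNat D
  let : DivisibleBy (Additive D) ℤ := divisibleByOfSMulRightSurj _ _ fun hn =>
    RootableBy.surjective_pow D ℤ hn
  obtain ⟨g, hg⟩ := (Module.Baer.of_divisible (Additive D)).extension_property_addMonoidHom
    (MonoidHom.toAdditive i) hi (MonoidHom.toAdditive f)
  exact ⟨MonoidHom.toAdditive.symm g, MonoidHom.ext fun a => DFunLike.congr_fun hg (.ofMul a)⟩

theorem le_of_divisible_of_finiteIndex [Fact p.Prime] (hG : IsPGroup p G) {D : Subgroup G}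
    (hD : Function.Surjective fun a : D => a ^ p) (K : Subgroup G) [K.FiniteIndex] : D ≤ K := by
  intro d hd
  obtain ⟨k, hk⟩ := hG.index K.normalCore
  obtain ⟨b, hb⟩ := surjective_pow_pow hD k ⟨d, hd⟩
  have hbd : (b : G) ^ p ^ k = d := congrArg Subtype.val hb
  apply K.normalCore_le
  rw [← hbd, ← hk]
  exact Subgroup.pow_index_mem _ _

end PGroup

section PowRange

variable {p : ℕ} {A : Type*} [CommGroup A]

theorem antitone_range_powMonoidHom_pow (p : ℕ) :
    Antitone fun n => (powMonoidHom (p ^ n) : A →* A).range :=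
  antitone_nat_of_succ_le fun n => by
    rintro _ ⟨a, rfl⟩
    exact ⟨a ^ p, by simp [← pow_mul, ← pow_succ']⟩

theorem exists_forall_mem_iInter_of_antitone {α : Type*} {s : ℕ → Set α} (hs : Antitone s)
    {t : Set α} (ht : t.Finite) : ∃ n, ∀ a ∈ t, a ∈ s n → a ∈ ⋂ m, s m := by
  refine (ht.eventually_all (l := Filter.atTop).2 fun a _ => ?_).exists
  by_cases ha : a ∈ ⋂ m, s m
  · exact .of_forall fun _ _ => ha
  · obtain ⟨m, hm⟩ := not_forall.1 (mt Set.mem_iInter.2 ha)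
    exact (Filter.eventually_ge_atTop m).mono fun n hn hna => (hm (hs hn hna)).elim

theorem surjective_pow_iInf_range_powMonoidHom_pow (hfin : (torsionSet p A).Finite) :
    Function.Surjective
      fun a : (⨅ n, (powMonoidHom (p ^ n) : A →* A).range : Subgroup A) => a ^ p := by
  rintro ⟨a, ha⟩
  obtain ⟨n, hn⟩ := exists_forall_mem_iInter_of_antitone
    (antitone_range_powMonoidHom_pow (A := A) p) (finite_setOf_pow_eq hfin a)
  obtain ⟨c, rfl⟩ := Subgroup.mem_iInf.1 ha (n + 1)
  have hc := hn (c ^ p ^ n) (by simp [← pow_mul, ← pow_succ]) ⟨c, rfl⟩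
  exact ⟨⟨c ^ p ^ n, by simpa using hc⟩, Subtype.ext (by simp [← pow_mul, ← pow_succ])⟩

theorem finiteIndex_range_powMonoidHom {n : ℕ} (hfin : (torsionSet n A).Finite)
    (hdiv : Function.Surjective fun a : (powMonoidHom n : A →* A).range => a ^ n) :
    (powMonoidHom n : A →* A).range.FiniteIndex := by
  have : Finite (torsionSet n A) := hfin
  have : Finite (A ⧸ (powMonoidHom n : A →* A).range) := by
    refine Finite.of_surjective (fun a : torsionSet n A => (a.1 : A ⧸ _)) fun q => ?_
    obtain ⟨a, rfl⟩ := QuotientGroup.mk_surjective q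
    obtain ⟨b, hb⟩ := hdiv ⟨a ^ n, a, rfl⟩
    have hb' : (b : A) ^ n = a ^ n := congrArg Subtype.val hb
    refine ⟨⟨a * (b : A)⁻¹, ?_⟩, QuotientGroup.eq.2 (by simp)⟩
    change (a * (b : A)⁻¹) ^ n = 1
    rw [mul_pow, inv_pow, hb', mul_inv_cancel]
  exact Subgroup.finiteIndex_of_finite_quotient

theorem exists_finiteIndex_divisible {A : Type*} [Group A] [IsMulCommutative A]
    (hA : IsPGroup p A) (hfin : (torsionSet p A).Finite) :
    ∃ D : Subgroup A, D.FiniteIndex ∧ Function.Surjective fun a : D => a ^ p := by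
  let R (n : ℕ) : Subgroup A := (powMonoidHom (p ^ n) : A →* A).range
  have hdiv : Function.Surjective fun a : (⨅ n, R n : Subgroup A) => a ^ p :=
    surjective_pow_iInf_range_powMonoidHom_pow hfin
  obtain ⟨n, hn⟩ := exists_forall_mem_iInter_of_antitone
    (antitone_range_powMonoidHom_pow (A := A) p) hfin
  have hR : ⨅ m, R m = R n := by
    have hsurj := surjective_of_torsionSet_subset_range (hA.to_subgroup (R n)) hdiv
      (Subgroup.inclusion (iInf_le R n)) fun a ha =>
        ⟨⟨a, by simpa [R] using hn a (congrArg Subtype.val ha) a.2⟩, rfl⟩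
    refine le_antisymm (iInf_le R n) fun a ha => ?_
    obtain ⟨b, hb⟩ := hsurj ⟨a, ha⟩
    have hba : (b : A) = a := congrArg Subtype.val hb
    exact hba ▸ b.2
  rw [hR] at hdiv
  exact ⟨R n, finiteIndex_range_powMonoidHom (finite_torsionSet_pow hfin n)
    (surjective_pow_pow hdiv n), hdiv⟩

end PowRange

/-- A `p`-torus: an abelian `p`-group that is `p`-divisible and has finite `p`-torsion. By
`IsPTorus.nonempty_mulEquiv_iff` these are the groups `(ℤ/p^∞)^r`, described without coordinates. -/
structure IsPTorus (p : ℕ) (D : Type*) [Group D] : Prop where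
  isMulCommutative : IsMulCommutative D
  isPGroup : IsPGroup p D
  divisible : Function.Surjective fun a : D => a ^ p
  finite_torsionSet : (torsionSet p D).Finite

namespace IsPTorus

variable {p : ℕ} {D E : Type*} [Group D] [Group E]

theorem of_mulEquiv (hE : IsPTorus p E) (e : D ≃* E) : IsPTorus p D where
  isMulCommutative := have := hE.isMulCommutative
    ⟨⟨fun a b => e.injective (by rw [map_mul, map_mul, mul_comm])⟩⟩
  isPGroup := hE.isPGroup.of_injective e.toMonoidHom e.injective
  divisible a := by
    obtain ⟨b, hb⟩ := hE.divisible (e a)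
    exact ⟨e.symm b, e.injective (by simpa using hb)⟩
  finite_torsionSet := finite_torsionSet_of_injective (f := e.toMonoidHom) e.injective
    hE.finite_torsionSet

theorem pi {ι : Type*} [Finite ι] (hD : IsPTorus p D) : IsPTorus p (ι → D) where
  isMulCommutative := have := hD.isMulCommutative
    ⟨⟨mul_comm⟩⟩
  isPGroup a := by
    have := Fintype.ofFinite ι
    choose n hn using fun i => hD.isPGroup (a i)
    refine ⟨∑ i, n i, funext fun i => ?_⟩
    have hi : n i ≤ ∑ i, n i := Finset.single_le_sum (fun _ _ => Nat.zero_le _) (Finset.mem_univ i)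
    exact orderOf_dvd_iff_pow_eq_one.1
      ((orderOf_dvd_of_pow_eq_one (hn i)).trans (pow_dvd_pow p hi))
  divisible := Function.Surjective.piMap fun _ => hD.divisible
  finite_torsionSet := by
    refine (Set.Finite.pi' fun _ : ι => hD.finite_torsionSet).subset fun a ha i => ?_
    exact congrFun ha i

variable [Fact p.Prime]

theorem exists_ncard_torsionSet (hD : IsPTorus p D) : ∃ r, (torsionSet p D).ncard = p ^ r := by
  have := hD.isMulCommutative
  let W : Subgroup D := (powMonoidHom p : D →* D).ker
  have : Finite W := hD.finite_torsionSet
  exact (IsPGroup.iff_card (G := W)).1 (hD.isPGroup.to_subgroup W)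

theorem nonempty_mulEquiv (hD : IsPTorus p D) (hE : IsPTorus p E)
    (h : (torsionSet p D).ncard = (torsionSet p E).ncard) : Nonempty (D ≃* E) := by
  have := hD.isMulCommutative
  have := hE.isMulCommutative
  let A := (powMonoidHom p : D →* D).ker
  let B := (powMonoidHom p : E →* E).ker
  have : Finite A := hD.finite_torsionSet
  have : Finite B := hE.finite_torsionSet
  obtain ⟨e⟩ : Nonempty (A ≃* B) := nonempty_mulEquiv_of_forall_pow_prime_eq_one (p := p)
    (fun a => Subtype.ext a.2) (fun b => Subtype.ext b.2) h
  obtain ⟨g, hg⟩ := exists_comp_eq_of_injective_of_divisible hE.isPGroup hE.divisible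
    A.subtype_injective (B.subtype.comp e.toMonoidHom)
  have hge (a : A) : g a = e a := DFunLike.congr_fun hg a
  refine ⟨MulEquiv.ofBijective g ⟨?_, ?_⟩⟩
  · refine injective_of_torsionSet hD.isPGroup g fun a ha h1 => ?_
    have he : e ⟨a, ha⟩ = 1 := Subtype.ext ((hge ⟨a, ha⟩).symm.trans h1)
    exact congrArg Subtype.val ((map_eq_one_iff _ e.injective).1 he)
  · refine surjective_of_torsionSet_subset_range hE.isPGroup hD.divisible g fun b hb =>
      ⟨e.symm ⟨b, hb⟩, ?_⟩
    rw [hge, e.apply_symm_apply]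

end IsPTorus

section PruferGroup

variable {p : ℕ} [Fact p.Prime]

theorem ncard_torsionSet_pruferGroup : (torsionSet p (PruferGroup p)).ncard = p := by
  refine Eq.trans (Nat.card_congr ?_) (HasEnoughRootsOfUnity.natCard_rootsOfUnity Circle p)
  exact
    { toFun a := ⟨toUnits (a : Circle),
        (mem_rootsOfUnity' _ _).2 (congrArg Subtype.val a.2)⟩
      invFun u := ⟨⟨(u : Circleˣ), 1, by simpa using (mem_rootsOfUnity' _ _).1 u.2⟩,
        Subtype.ext ((mem_rootsOfUnity' _ _).1 u.2)⟩
      left_inv _ := rfl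
      right_inv u := by ext; rfl }

theorem surjective_pow_pruferGroup : Function.Surjective fun a : PruferGroup p => a ^ p := by
  rintro ⟨a, n, hn⟩
  obtain ⟨t, rfl⟩ := Circle.exp_surjective a
  have hp : (p : ℝ) ≠ 0 := Nat.cast_ne_zero.2 (Fact.out : p.Prime).ne_zero
  have hroot : Circle.exp (t / p) ^ p = Circle.exp t := by
    rw [← Circle.exp_natCast_mul, mul_div_cancel₀ t hp]
  exact ⟨⟨Circle.exp (t / p), n + 1, by rw [pow_succ', pow_mul, hroot, hn]⟩, Subtype.ext hroot⟩

theorem isPTorus_pruferGroup : IsPTorus p (PruferGroup p) where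
  isMulCommutative := inferInstance
  isPGroup := fun ⟨_, n, hn⟩ => ⟨n, Subtype.ext hn⟩
  divisible := surjective_pow_pruferGroup
  finite_torsionSet := Set.finite_of_ncard_ne_zero <| by
    rw [ncard_torsionSet_pruferGroup]
    exact (Fact.out : p.Prime).ne_zero

theorem IsPTorus.nonempty_mulEquiv_iff {D : Type*} [Group D] (hD : IsPTorus p D) (r : ℕ) :
    Nonempty (D ≃* (Fin r → PruferGroup p)) ↔ (torsionSet p D).ncard = p ^ r := by
  have hcard : (torsionSet p (Fin r → PruferGroup p)).ncard = p ^ r := by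
    rw [ncard_torsionSet_pi, ncard_torsionSet_pruferGroup, Nat.card_fin]
  refine ⟨fun ⟨e⟩ => by rw [ncard_torsionSet_congr e, hcard], fun h => ?_⟩
  exact hD.nonempty_mulEquiv isPTorus_pruferGroup.pi (h.trans hcard.symm)

end PruferGroup

/-! ### Discrete `p`-toral groups -/

section IdentityComponent

variable {H G : Type*} [Group H] [Group G]

theorem identityComponent_le (K : Subgroup G) [hK : K.FiniteIndex] : identityComponent G ≤ K :=
  sInf_le hK

theorem finiteIndex_comap (f : H →* G) (K : Subgroup G) [hK : K.FiniteIndex] :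
    (K.comap f).FiniteIndex := ⟨by
  rw [Subgroup.index_comap]
  refine fun h0 => hK.index_ne_zero ?_
  rw [← Subgroup.relIndex_top_right]
  exact Subgroup.relIndex_eq_zero_of_le_right le_top h0⟩

theorem map_identityComponent_le (f : H →* G) :
    (identityComponent H).map f ≤ identityComponent G :=
  le_sInf fun K (_ : K.FiniteIndex) =>
    have := finiteIndex_comap f K
    Subgroup.map_le_iff_le_comap.2 (identityComponent_le (K.comap f))

theorem identityComponent_normal (G : Type*) [Group G] : (identityComponent G).Normal :=
  ⟨fun a ha g => map_identityComponent_le (MulAut.conj g).toMonoidHom ⟨a, ha, rfl⟩⟩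

/-- The restriction of a homomorphism to identity components. -/
def identityComponentMap (f : H →* G) : identityComponent H →* identityComponent G :=
  (f.comp (identityComponent H).subtype).codRestrict _
    fun a => map_identityComponent_le f ⟨a, a.2, rfl⟩

theorem identityComponentMap_injective {f : H →* G} (hf : Function.Injective f) :
    Function.Injective (identityComponentMap f) := fun _ _ hab =>
  Subtype.ext (hf (congrArg Subtype.val hab))

theorem index_identityComponent_mul_index_range {f : H →* G} (hf : Function.Injective f)
    (h : (identityComponent H).map f = identityComponent G) :
    (identityComponent H).index * f.range.index = (identityComponent G).index := by
  rw [← h, Subgroup.index_map_of_injective _ hf]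

end IdentityComponent

/-- The intrinsic form of `IsDiscretePToral`: a `p`-group whose identity component is a `p`-torus
of finite index. -/
structure IsPToral (p : ℕ) (G : Type*) [Group G] : Prop where
  isPGroup : IsPGroup p G
  finiteIndex : (identityComponent G).FiniteIndex
  isPTorus : IsPTorus p (identityComponent G)

theorem IsPToral.index_identityComponent_pos {p : ℕ} {G : Type*} [Group G] (hG : IsPToral p G) :
    0 < (identityComponent G).index :=
  Nat.pos_of_ne_zero hG.finiteIndex.index_ne_zero

section Toral

variable {p : ℕ} [Fact p.Prime] {H G : Type*} [Group H] [Group G]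

theorem identityComponent_eq_of_divisible (hG : IsPGroup p G) {D : Subgroup G}
    (hfi : D.FiniteIndex) (hD : Function.Surjective fun a : D => a ^ p) :
    identityComponent G = D :=
  le_antisymm (sInf_le hfi) <| le_sInf fun K (_ : K.FiniteIndex) =>
    le_of_divisible_of_finiteIndex hG hD K

namespace IsPToral

theorem of_finiteIndex (hG : IsPGroup p G) {D : Subgroup G} (hfi : D.FiniteIndex)
    (hD : IsPTorus p D) : IsPToral p G := by
  have h : identityComponent G = D := identityComponent_eq_of_divisible hG hfi hD.divisible
  exact ⟨hG, h ▸ hfi, h ▸ hD⟩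

theorem of_isDiscretePToral (hG : IsDiscretePToral p G) : IsPToral p G := by
  obtain ⟨T, hT, r, ⟨e⟩, hfin, hquot⟩ := hG
  have hTorus : IsPTorus p T := isPTorus_pruferGroup.pi.of_mulEquiv e
  refine of_finiteIndex (fun g => ?_) Subgroup.finiteIndex_of_finite_quotient hTorus
  obtain ⟨k, hk⟩ := hquot (g : G ⧸ T)
  have hgT : g ^ p ^ k ∈ T := by rw [← QuotientGroup.eq_one_iff, QuotientGroup.mk_pow, hk]
  obtain ⟨l, hl⟩ := hTorus.isPGroup ⟨_, hgT⟩
  exact ⟨k + l, by rw [pow_add, pow_mul]; exact congrArg Subtype.val hl⟩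

theorem of_injective (hG : IsPToral p G) {f : H →* G} (hf : Function.Injective f) :
    IsPToral p H := by
  have hH : IsPGroup p H := hG.isPGroup.of_injective f hf
  have := hG.finiteIndex
  have := hG.isPTorus.isMulCommutative
  let A : Subgroup H := (identityComponent G).comap f
  have : A.FiniteIndex := finiteIndex_comap f _
  have hfA : Function.Injective (f.subgroupComap (identityComponent G)) := fun _ _ hab =>
    Subtype.ext (hf (congrArg Subtype.val hab))
  have hcomm : IsMulCommutative A := ⟨⟨fun a b => hfA (by rw [map_mul, map_mul, mul_comm])⟩⟩
  have hfin : (torsionSet p A).Finite :=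
    finite_torsionSet_of_injective hfA hG.isPTorus.finite_torsionSet
  obtain ⟨D, hDfi, hD⟩ := exists_finiteIndex_divisible (hH.to_subgroup A) hfin
  have hDtorus : IsPTorus p D := ⟨inferInstance, (hH.to_subgroup A).to_subgroup D, hD,
    finite_torsionSet_of_injective D.subtype_injective hfin⟩
  refine of_finiteIndex hH (D := D.map A.subtype) ⟨?_⟩
    (hDtorus.of_mulEquiv (D.equivMapOfInjective _ A.subtype_injective).symm)
  rw [Subgroup.index_map_subtype]
  exact mul_ne_zero hDfi.index_ne_zero Subgroup.FiniteIndex.index_ne_zero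

theorem subgroup (hG : IsPToral p G) (H : Subgroup G) : IsPToral p H :=
  hG.of_injective H.subtype_injective

theorem pow_toralRank (hG : IsPToral p G) :
    p ^ toralRank p G = (torsionSet p (identityComponent G)).ncard := by
  obtain ⟨r, hr⟩ := hG.isPTorus.exists_ncard_torsionSet
  have hne : {r : ℕ | Nonempty (identityComponent G ≃* (Fin r → PruferGroup p))}.Nonempty :=
    ⟨r, (hG.isPTorus.nonempty_mulEquiv_iff r).2 hr⟩
  exact ((hG.isPTorus.nonempty_mulEquiv_iff _).1 (Nat.sInf_mem hne)).symm

theorem toralRank_le (hG : IsPToral p G) {f : H →* G} (hf : Function.Injective f) :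
    toralRank p H ≤ toralRank p G := by
  rw [← Nat.pow_le_pow_iff_right (Fact.out : p.Prime).one_lt, (hG.of_injective hf).pow_toralRank,
    hG.pow_toralRank]
  exact Set.ncard_le_ncard_of_injOn _ (mapsTo_torsionSet (identityComponentMap f) p)
    (identityComponentMap_injective hf).injOn hG.isPTorus.finite_torsionSet

theorem map_identityComponent_eq (hG : IsPToral p G) {f : H →* G} (hf : Function.Injective f)
    (hr : toralRank p G ≤ toralRank p H) : (identityComponent H).map f = identityComponent G := by
  have hH := hG.of_injective hf
  have := hG.isPTorus.isMulCommutative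
  let f₀ := identityComponentMap f
  have himage : f₀ '' torsionSet p _ = torsionSet p _ :=
    Set.eq_of_subset_of_ncard_le (mapsTo_torsionSet f₀ p).image_subset (by
      rw [Set.ncard_image_of_injective _ (identityComponentMap_injective hf), ← hG.pow_toralRank,
        ← hH.pow_toralRank]
      exact Nat.pow_le_pow_right (Fact.out : p.Prime).pos hr) hG.isPTorus.finite_torsionSet
  have hsurj : Function.Surjective f₀ :=
    surjective_of_torsionSet_subset_range hG.isPTorus.isPGroup hH.isPTorus.divisible f₀
      (himage ▸ Set.image_subset_range f₀ _)
  refine le_antisymm (map_identityComponent_le f) fun g hg => ?_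
  obtain ⟨a, ha⟩ := hsurj ⟨g, hg⟩
  exact ⟨a, a.2, congrArg Subtype.val ha⟩

theorem toralOrder_le (hG : IsPToral p G) {f : H →* G} (hf : Function.Injective f) :
    toralOrder p H ≤ toralOrder p G := by
  refine Prod.Lex.toLex_le_toLex.2 ((hG.toralRank_le hf).lt_or_eq.imp_right fun hr => ⟨hr, ?_⟩)
  have hindex := index_identityComponent_mul_index_range hf (hG.map_identityComponent_eq hf hr.ge)
  exact Nat.le_of_dvd hG.index_identityComponent_pos ⟨_, hindex.symm⟩

theorem surjective_of_toralOrder_le (hG : IsPToral p G) {f : H →* G} (hf : Function.Injective f)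
    (h : toralOrder p G ≤ toralOrder p H) : Function.Surjective f := by
  obtain ⟨hrank, hle⟩ :=
    (Prod.Lex.toLex_le_toLex.1 h).resolve_left (hG.toralRank_le hf).not_gt
  have hindex := index_identityComponent_mul_index_range hf
    (hG.map_identityComponent_eq hf hrank.le)
  have hpos := (hG.of_injective hf).index_identityComponent_pos
  rw [← MonoidHom.range_eq_top, ← Subgroup.index_eq_one]
  refine le_antisymm (Nat.le_of_mul_le_mul_left (hindex.trans_le (hle.trans_eq ?_)) hpos) ?_
  · exact (mul_one _).symm
  · exact Nat.pos_of_mul_pos_left (hindex ▸ hG.index_identityComponent_pos)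

end IsPToral

end Toral

/-! ### Elements of order `p` fixed by automorphisms -/

section FixedPoints

variable {p : ℕ}

theorem exists_conj_not_dvd_index {L G : Type*} [Group L] [Group G] (u : L →* G)
    {A B : Subgroup G} (hu : u.range ≤ B) (h : ¬ p ∣ A.relIndex B) :
    ∃ γ ∈ B, ¬ p ∣ ((A.comap (MulAut.conj γ⁻¹).toMonoidHom).comap u).index := by
  let X := B ⧸ A.subgroupOf B
  let u' : L →* B := u.codRestrict B fun l => hu ⟨l, rfl⟩
  let : MulAction L X := MulAction.compHom _ u'
  have hX : Finite X := Nat.finite_of_card_ne_zero fun h0 => h (.trans (dvd_zero p) h0.symm.dvd)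
  have : Fintype (MulAction.orbitRel.Quotient L X) := Fintype.ofFinite _
  by_contra! hdvd
  refine h ?_
  rw [Subgroup.relIndex, Subgroup.index, Nat.card_congr (MulAction.selfEquivSigmaOrbits L X),
    Nat.card_sigma]
  refine Finset.dvd_sum fun ω _ => ?_
  obtain ⟨γ, hγ⟩ := QuotientGroup.mk_surjective (Quotient.out ω)
  have hstab : (A.comap (MulAut.conj (γ : G)⁻¹).toMonoidHom).comap u =
      MulAction.stabilizer L (γ : X) := by
    ext l
    have hsmul : l • (γ : X) = ((u' l * γ : B) : X) := rfl
    rw [MulAction.mem_stabilizer_iff, hsmul, eq_comm, QuotientGroup.eq, Subgroup.mem_subgroupOf]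
    simp [u', mul_assoc]
  rw [← hγ, Nat.card_coe_set_eq, ← MulAction.index_stabilizer, ← hstab]
  exact hdvd γ γ.2

variable [Fact p.Prime]

theorem exists_conj_le_of_isPGroup {G : Type*} [Group G] {A B H : Subgroup G}
    (hH : IsPGroup p H) (hHB : H ≤ B) (h : ¬ p ∣ A.relIndex B) :
    ∃ γ ∈ B, ∀ g ∈ H, γ⁻¹ * g * γ ∈ A := by
  let : MulAction H (B ⧸ A.subgroupOf B) := MulAction.compHom _ (Subgroup.inclusion hHB)
  obtain ⟨q, hq⟩ := hH.nonempty_fixed_point_of_prime_not_dvd_card (B ⧸ A.subgroupOf B) h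
  obtain ⟨γ, rfl⟩ := QuotientGroup.mk_surjective q
  refine ⟨γ, γ.2, fun g hg => ?_⟩
  have hfix : ((Subgroup.inclusion hHB ⟨g, hg⟩ * γ : B) : B ⧸ A.subgroupOf B) = γ := hq ⟨g, hg⟩
  rw [eq_comm, QuotientGroup.eq, Subgroup.mem_subgroupOf] at hfix
  simpa [mul_assoc] using hfix

/-- A Sylow subgroup of the image of `B` in the permutations of `V` has a second fixed point,
and its preimage in `B` has index prime to `p`. -/
theorem exists_fixed_point_not_dvd_index_stabilizer {B V : Type*} [Group B] [MulAction B V]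
    [Finite V] {A : Subgroup B} (hA : IsPGroup p A) (hV : p ∣ Nat.card V) {v₀ : V}
    (hv₀ : ∀ b : B, b • v₀ = v₀) :
    ∃ v ≠ v₀, (∀ a ∈ A, a • v = v) ∧ ¬ p ∣ (MulAction.stabilizer B v).index := by
  let π := (MulAction.toPermHom B V).rangeRestrict
  have hπ : Function.Surjective π := MonoidHom.rangeRestrict_surjective _
  obtain ⟨Γ, hΓ⟩ := (hA.map π).exists_le_sylow
  obtain ⟨v, hv, hne⟩ := Γ.isPGroup'.exists_fixed_point_of_prime_dvd_card_of_fixed_point V hV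
    (a := v₀) fun ⟨⟨_, b, hb⟩, _⟩ => (DFunLike.congr_fun hb v₀).symm.trans (hv₀ b)
  have hfix (b : B) (hb : π b ∈ Γ) : b • v = v := hv ⟨π b, hb⟩
  refine ⟨v, hne.symm, fun a ha => hfix a (hΓ ⟨a, ha, rfl⟩), fun hdvd => Γ.not_dvd_index ?_⟩
  rw [← Subgroup.index_comap_of_surjective (Γ : Subgroup _) hπ]
  exact hdvd.trans (Subgroup.index_dvd_of_le hfix)

variable {G : Type*} [Group G]

theorem exists_orderOf_pow_eq_prime (hG : IsPGroup p G) {g : G} (hg : g ≠ 1) :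
    ∃ k, orderOf (g ^ k) = p := by
  obtain ⟨n, hn⟩ := IsPGroup.iff_orderOf.1 hG g
  have hn0 : n ≠ 0 := fun h0 => hg (orderOf_eq_one_iff.1 (by rw [hn, h0, pow_zero]))
  have hpos : orderOf g ≠ 0 := hn ▸ pow_ne_zero n (Fact.out : p.Prime).ne_zero
  exact ⟨_, orderOf_pow_orderOf_div hpos (hn ▸ dvd_pow_self p hn0)⟩

theorem prime_dvd_card_of_ne_bot (hG : IsPGroup p G) {W : Subgroup G} [Finite W]
    (hW : W ≠ ⊥) : p ∣ Nat.card W := by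
  have := W.nontrivial_iff_ne_bot.2 hW
  obtain ⟨n, hn, hcard⟩ := (hG.to_subgroup W).nontrivial_iff_card.1 this
  exact hcard ▸ dvd_pow_self p hn.ne'

theorem exists_ne_one_mem_center (hG : IsPGroup p G) {W : Subgroup G} [W.Normal] [Finite W]
    (hW : W ≠ ⊥) : ∃ x ∈ Subgroup.center G, x ≠ 1 := by
  let : MulAction G W := MulAction.compHom W (MulAut.conjNormal (H := W))
  obtain ⟨b, hb, hb1⟩ := hG.exists_fixed_point_of_prime_dvd_card_of_fixed_point W
    (prime_dvd_card_of_ne_bot hG hW) (a := 1) fun g => map_one (MulAut.conjNormal (H := W) g)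
  refine ⟨b, Subgroup.mem_center_iff.2 fun g => ?_, fun h => hb1 (Subtype.ext h.symm)⟩
  have hgb : g * b * g⁻¹ = b := congrArg Subtype.val (hb g)
  exact mul_inv_eq_iff_eq_mul.1 hgb

end FixedPoints

/-- The subgroup of central elements of order dividing `p`. -/
def centerTorsion (p : ℕ) (G : Type*) [Group G] : Subgroup G where
  carrier := {g | g ∈ Subgroup.center G ∧ g ^ p = 1}
  one_mem' := ⟨one_mem _, one_pow _⟩
  mul_mem' := fun {a b} ha hb => ⟨mul_mem ha.1 hb.1, by
    rw [(show Commute a b from (Subgroup.mem_center_iff.1 hb.1 a)).mul_pow, ha.2, hb.2, one_mul]⟩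
  inv_mem' := fun ha => ⟨inv_mem ha.1, by rw [inv_pow, ha.2, inv_one]⟩

theorem apply_mem_centerTorsion {p : ℕ} {G : Type*} [Group G] (α : MulAut G) {g : G}
    (hg : g ∈ centerTorsion p G) : α g ∈ centerTorsion p G := by
  refine ⟨Subgroup.mem_center_iff.2 fun h => ?_, by rw [← map_pow, hg.2, map_one]⟩
  obtain ⟨k, rfl⟩ := α.surjective h
  rw [← map_mul, ← map_mul, Subgroup.mem_center_iff.1 hg.1]

namespace IsPToral

section Center

variable {p : ℕ} {G : Type*} [Group G]

theorem finite_of_identityComponent_eq_bot (hG : IsPToral p G) (h : identityComponent G = ⊥) :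
    Finite G :=
  Nat.finite_of_card_ne_zero (Subgroup.index_bot (G := G) ▸ h ▸ hG.finiteIndex.index_ne_zero)

variable [Fact p.Prime]

theorem finite_centerTorsion (hG : IsPToral p G) : Finite (centerTorsion p G) := by
  have hV := hG.subgroup (centerTorsion p G)
  refine hV.finite_of_identityComponent_eq_bot (eq_bot_iff.2 fun a ha => ?_)
  obtain ⟨b, hb⟩ := hV.isPTorus.divisible ⟨a, ha⟩
  have hba : (b : centerTorsion p G) ^ p = a := congrArg Subtype.val hb
  exact hba.symm.trans (Subtype.ext (b : centerTorsion p G).2.2)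

theorem exists_finite_normal_ne_bot (hG : IsPToral p G) [Nontrivial G] :
    ∃ W : Subgroup G, W.Normal ∧ Finite W ∧ W ≠ ⊥ := by
  by_cases hbot : identityComponent G = ⊥
  · have := hG.finite_of_identityComponent_eq_bot hbot
    exact ⟨⊤, inferInstance, inferInstance, top_ne_bot⟩
  have := hG.isPTorus.isMulCommutative
  let W : Subgroup (identityComponent G) := (powMonoidHom p).ker
  have hWfin : Finite W := hG.isPTorus.finite_torsionSet
  refine ⟨W.map (identityComponent G).subtype, ⟨?_⟩, Set.Finite.image _ hWfin, fun hW => ?_⟩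
  · rintro _ ⟨a, ha, rfl⟩ g
    refine ⟨⟨_, (identityComponent_normal G).conj_mem a a.2 g⟩, Subtype.ext ?_, rfl⟩
    have hap : (a : G) ^ p = 1 := congrArg Subtype.val ha
    change (g * a * g⁻¹) ^ p = 1
    rw [conj_pow, hap, mul_one, mul_inv_cancel]
  · obtain ⟨a, ha⟩ := (identityComponent G).bot_or_exists_ne_one.resolve_left hbot
    obtain ⟨k, hk⟩ := exists_orderOf_pow_eq_prime hG.isPGroup ha.2
    have hmem : a ^ k ∈ W.map (identityComponent G).subtype :=
      ⟨⟨_, pow_mem ha.1 k⟩, Subtype.ext (orderOf_dvd_iff_pow_eq_one.1 hk.dvd), rfl⟩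
    rw [hW, Subgroup.mem_bot] at hmem
    rw [hmem, orderOf_one] at hk
    exact (Fact.out : p.Prime).ne_one hk.symm

theorem centerTorsion_ne_bot (hG : IsPToral p G) [Nontrivial G] : centerTorsion p G ≠ ⊥ := by
  obtain ⟨W, _, _, hW⟩ := hG.exists_finite_normal_ne_bot
  obtain ⟨x, hx, hx1⟩ := exists_ne_one_mem_center hG.isPGroup hW
  obtain ⟨k, hk⟩ := exists_orderOf_pow_eq_prime hG.isPGroup hx1
  refine fun hbot => (Fact.out : p.Prime).ne_one ?_
  have hmem : x ^ k ∈ centerTorsion p G := ⟨pow_mem hx k, orderOf_dvd_iff_pow_eq_one.1 hk.dvd⟩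
  rw [hbot, Subgroup.mem_bot] at hmem
  rw [← hk, hmem, orderOf_one]

theorem exists_fixed_orderOf_eq (hG : IsPToral p G) [Nontrivial G] {A B : Subgroup (MulAut G)}
    (hA : IsPGroup p A) (hAB : A ≤ B) :
    ∃ x ∈ Subgroup.center G, orderOf x = p ∧ (∀ α ∈ A, α x = x) ∧
      ¬ p ∣ (MulAction.stabilizer (MulAut G) x).relIndex B := by
  let V := centerTorsion p G
  have hVfin : Finite V := hG.finite_centerTorsion
  let : MulAction B V :=
    { smul := fun β v => ⟨β.1 v, apply_mem_centerTorsion β.1 v.2⟩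
      one_smul := fun _ => rfl
      mul_smul := fun _ _ _ => rfl }
  have hAB' : IsPGroup p (A.subgroupOf B) :=
    hA.of_injective (Subgroup.subgroupOfEquivOfLe hAB).toMonoidHom (MulEquiv.injective _)
  obtain ⟨x, hx1, hxA, hxB⟩ := exists_fixed_point_not_dvd_index_stabilizer hAB'
    (prime_dvd_card_of_ne_bot hG.isPGroup hG.centerTorsion_ne_bot)
    (v₀ := (1 : V)) fun β => Subtype.ext (map_one β.1)
  refine ⟨x, x.2.1, orderOf_eq_prime x.2.2 fun h => hx1 (Subtype.ext h),
    fun α hα => congrArg Subtype.val (hxA ⟨α, hAB hα⟩ hα), ?_⟩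
  have hstab : (MulAction.stabilizer (MulAut G) (x : G)).subgroupOf B =
      MulAction.stabilizer B x := 
    Subgroup.ext fun β => (Subtype.ext_iff (a1 := β • x) (a2 := x)).symm
  rwa [Subgroup.relIndex, hstab]

end Center

end IsPToral

/-! ### The number of components of a normalizer -/

section Norm

variable {Γ T : Type*} [Group Γ] [Fintype Γ] [CommGroup T]

/-- The norm homomorphism `t ↦ ∏ c, c t` of a finite group `Γ` acting on an abelian group. -/
def actionNorm (g : Γ →* MulAut T) : T →* T where
  toFun t := ∏ c, g c t
  map_one' := by simp
  map_mul' a b := by simp [Finset.prod_mul_distrib]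

theorem apply_actionNorm (g : Γ →* MulAut T) (c : Γ) (t : T) :
    g c (actionNorm g t) = actionNorm g t :=
  (map_prod (g c) _ _).trans <| Fintype.prod_equiv (Equiv.mulLeft c) _ _ fun d => by simp

theorem actionNorm_div_pow_card (g : Γ →* MulAut T) (t : T) :
    actionNorm g t / t ^ Fintype.card Γ = ∏ c, g c t / t := by
  rw [Finset.prod_div_distrib, Finset.prod_const, Finset.card_univ]
  rfl

end Norm

theorem relIndex_le_ncard_torsionSet {T : Type*} [Group T] [IsMulCommutative T]
    {M A : Subgroup T} {e : ℕ} (hA : ∀ a ∈ A, a ^ e ∈ M)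
    (hM : Function.Surjective fun m : M => m ^ e) (hfin : (torsionSet e T).Finite) :
    M.relIndex A ≤ (torsionSet e T).ncard := by
  conv_lhs => rw [← QuotientGroup.ker_mk' M, Subgroup.relIndex_ker]
  refine (Set.ncard_le_ncard ?_ (hfin.image (QuotientGroup.mk' M))).trans
    (Set.ncard_image_le hfin)
  rintro _ ⟨a, ha, rfl⟩
  obtain ⟨m, hm⟩ := hM ⟨_, hA a ha⟩
  have hma : (m : T) ^ e = a ^ e := congrArg Subtype.val hm
  refine ⟨a / m, ?_, QuotientGroup.eq.2 (by simp)⟩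
  change (a / m) ^ e = 1
  rw [div_pow, hma, div_self']

section ComponentAction

variable {S : Type*} [Group S] (Q : Subgroup S)

attribute [local instance] identityComponent_normal

/-- The conjugation action of `Q` on an abelian identity component `T`, as an action of
`Q / (Q ∩ T)`. -/
def componentAction [IsMulCommutative (identityComponent S)] :
    Q ⧸ (identityComponent S).subgroupOf Q →* MulAut (identityComponent S) :=
  QuotientGroup.lift _ ((MulAut.conjNormal (H := identityComponent S)).comp Q.subtype) <| by
    intro q hq
    ext t
    exact mul_inv_eq_iff_eq_mul.2 (congrArg Subtype.val (mul_comm ⟨q, hq⟩ t))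

theorem coe_componentAction_mk [IsMulCommutative (identityComponent S)] (q : Q)
    (t : identityComponent S) :
    (componentAction Q (q : Q ⧸ _) t : S) = q * t * (q : S)⁻¹ := rfl

variable {Q} in
theorem coe_componentAction_div_mem [IsMulCommutative (identityComponent S)]
    (c : Q ⧸ (identityComponent S).subgroupOf Q) {t : identityComponent S}
    (ht : (t : S) ∈ Subgroup.normalizer (Q : Set S)) :
    ((componentAction Q c t / t : identityComponent S) : S) ∈ Q := by
  obtain ⟨q, rfl⟩ := QuotientGroup.mk_surjective c
  rw [Subgroup.coe_div, coe_componentAction_mk, div_eq_mul_inv, mul_assoc (q : S),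
    mul_assoc (q : S)]
  exact mul_mem q.2 ((Subgroup.mem_normalizer_iff.1 ht _).1 (inv_mem q.2))

end ComponentAction

namespace IsPToral

attribute [local instance] identityComponent_normal

variable {p : ℕ} [Fact p.Prime] {S : Type*} [Group S]

theorem le_map_identityComponent (hS : IsPToral p S) {D N : Subgroup S} (hDN : D ≤ N)
    (hD : Function.Surjective fun a : D => a ^ p) :
    D ≤ (identityComponent N).map N.subtype := by
  have hN := hS.subgroup N
  have := hN.finiteIndex
  have hle : D.subgroupOf N ≤ identityComponent N := by
    refine le_of_divisible_of_finiteIndex hN.isPGroup (fun ⟨a, ha⟩ => ?_) _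
    obtain ⟨b, hb⟩ := hD ⟨a, ha⟩
    have hba : (b : S) ^ p = a := congrArg Subtype.val hb
    exact ⟨⟨⟨b, hDN b.2⟩, b.2⟩, Subtype.ext (Subtype.ext hba)⟩
  exact fun d hd => ⟨⟨d, hDN hd⟩, hle hd, rfl⟩

theorem map_identityComponent_mono (hS : IsPToral p S) {Q N : Subgroup S} (hQN : Q ≤ N) :
    (identityComponent Q).map Q.subtype ≤ (identityComponent N).map N.subtype := by
  refine hS.le_map_identityComponent ((Subgroup.map_subtype_le _).trans hQN) ?_
  rintro ⟨_, a, ha, rfl⟩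
  obtain ⟨b, hb⟩ := (hS.subgroup Q).isPTorus.divisible ⟨a, ha⟩
  refine ⟨⟨_, b, b.2, rfl⟩, Subtype.ext ?_⟩
  exact congrArg (fun z : identityComponent Q => ((z : Q) : S)) hb

theorem actionNorm_mem_identityComponent_normalizer (hS : IsPToral p S) (Q : Subgroup S)
    [IsMulCommutative (identityComponent S)] [Fintype (Q ⧸ (identityComponent S).subgroupOf Q)]
    (t : identityComponent S) :
    (actionNorm (componentAction Q) t : S) ∈
      (identityComponent (Subgroup.normalizer (Q : Set S))).map (Subgroup.subtype _) := by
  let ν := actionNorm (componentAction Q)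
  refine hS.le_map_identityComponent (D := ν.range.map (Subgroup.subtype _)) ?_ ?_
    ⟨_, ⟨t, rfl⟩, rfl⟩
  · rintro _ ⟨_, ⟨s, rfl⟩, rfl⟩
    refine Subgroup.centralizer_le_normalizer _ (Subgroup.mem_centralizer_iff.2 fun q hq => ?_)
    have hfix := congrArg Subtype.val
      (apply_actionNorm (componentAction Q) ((⟨q, hq⟩ : Q) : Q ⧸ _) s)
    rwa [coe_componentAction_mk, mul_inv_eq_iff_eq_mul] at hfix
  · rintro ⟨_, _, ⟨s, rfl⟩, rfl⟩
    obtain ⟨r, rfl⟩ := hS.isPTorus.divisible s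
    have hpow : (ν r : S) ^ p = ν (r ^ p) := congrArg Subtype.val (map_pow ν r p).symm
    exact ⟨⟨_, _, ⟨r, rfl⟩, rfl⟩, Subtype.ext hpow⟩

/-- For `a` in the identity component, the norm of `a` lies in the identity component of `N_S(Q)`
and differs from `a ^ m`, for `m = |Q / (Q ∩ T)|`, by a product of commutators in `Q`. -/
theorem pow_index_mul_index_mem (hS : IsPToral p S) (Q : Subgroup S) {a : S}
    (ha : a ∈ Subgroup.normalizer (Q : Set S)) (haT : a ∈ identityComponent S) :
    a ^ ((identityComponent S).index * (identityComponent Q).index) ∈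
      (identityComponent (Subgroup.normalizer (Q : Set S))).map (Subgroup.subtype _) := by
  let T := identityComponent S
  let M := (identityComponent (Subgroup.normalizer (Q : Set S))).map (Subgroup.subtype _)
  have := hS.finiteIndex
  have : IsMulCommutative T := hS.isPTorus.isMulCommutative
  have : (T.subgroupOf Q).FiniteIndex := finiteIndex_comap Q.subtype T
  let : Fintype (Q ⧸ T.subgroupOf Q) := Fintype.ofFinite _
  have hcard : Fintype.card (Q ⧸ T.subgroupOf Q) = T.relIndex Q := by
    rw [Subgroup.relIndex, Subgroup.index, Nat.card_eq_fintype_card]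
  let t : T := ⟨a, haT⟩
  let ν := actionNorm (componentAction Q) t
  have hν : ν ∈ M.subgroupOf T := hS.actionNorm_mem_identityComponent_normalizer Q t
  have hdiv : ν / t ^ T.relIndex Q ∈ Q.subgroupOf T := by
    rw [← hcard, actionNorm_div_pow_card]
    exact Subgroup.prod_mem _ fun c _ => coe_componentAction_div_mem c ha
  have hdiv_pow : (ν / t ^ T.relIndex Q) ^ (identityComponent Q).index ∈ M.subgroupOf T := by
    exact hS.map_identityComponent_mono Subgroup.le_normalizer
      ⟨_, Subgroup.pow_index_mem (identityComponent Q) ⟨_, hdiv⟩, rfl⟩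
  obtain ⟨w, hw⟩ := Subgroup.relIndex_dvd_index_of_normal T Q
  have hmem : t ^ (T.relIndex Q * (identityComponent Q).index) ∈ M.subgroupOf T := by
    rw [pow_mul, ← div_div_cancel ν (t ^ T.relIndex Q), div_pow]
    exact div_mem (pow_mem hν _) hdiv_pow
  have hpow := pow_mem hmem w
  rwa [← pow_mul, mul_right_comm, ← hw] at hpow

theorem exists_index_normalizer_le (hS : IsPToral p S) (j : ℕ) :
    ∃ B : ℕ, ∀ Q : Subgroup S, (identityComponent Q).index = j →
      (identityComponent (Subgroup.normalizer (Q : Set S))).index ≤ B := by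
  let T := identityComponent S
  refine ⟨(torsionSet (T.index * j) T).ncard * T.index, ?_⟩
  rintro Q rfl
  let N := Subgroup.normalizer (Q : Set S)
  let M := (identityComponent N).map N.subtype
  have hMT : M ≤ T := map_identityComponent_le N.subtype
  have hMN : M ≤ N := Subgroup.map_subtype_le _
  have := hS.finiteIndex
  have := (hS.subgroup Q).finiteIndex
  have : IsMulCommutative T := hS.isPTorus.isMulCommutative
  obtain ⟨k, hk⟩ := hS.isPGroup.index T
  obtain ⟨l, hl⟩ := (hS.subgroup Q).isPGroup.index (identityComponent Q)
  have he : T.index * (identityComponent Q).index = p ^ (k + l) := by rw [hk, hl, pow_add]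
  have hMdiv : Function.Surjective
      fun m : M.subgroupOf T => m ^ (T.index * (identityComponent Q).index) := by
    rintro ⟨a, m, hm, hma⟩
    obtain ⟨c, hc⟩ := surjective_pow_pow (hS.subgroup N).isPTorus.divisible (k + l) ⟨m, hm⟩
    refine ⟨⟨⟨c, hMT ⟨c, c.2, rfl⟩⟩, c, c.2, rfl⟩, Subtype.ext (Subtype.ext ?_)⟩
    rw [he]
    exact (congrArg (fun z : identityComponent N => ((z : N) : S)) hc).trans hma
  have hindex : (identityComponent N).index = M.relIndex (T ⊓ N) * (T ⊓ N).relIndex N := by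
    rw [Subgroup.relIndex_mul_relIndex M (T ⊓ N) N (le_inf hMT hMN) inf_le_right,
      Subgroup.relIndex, Subgroup.subgroupOf,
      Subgroup.comap_map_eq_self_of_injective N.subtype_injective]
  rw [hindex]
  refine Nat.mul_le_mul ?_ ?_
  · rw [← Subgroup.relIndex_subgroupOf inf_le_left]
    exact relIndex_le_ncard_torsionSet
      (fun a ha => hS.pow_index_mul_index_mem Q ha.2 a.2) hMdiv
      (by rw [he]; exact finite_torsionSet_pow hS.isPTorus.finite_torsionSet _)
  · rw [Subgroup.inf_relIndex_right]
    exact Nat.le_of_dvd hS.index_identityComponent_pos (Subgroup.relIndex_dvd_index_of_normal T N)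

end IsPToral

/-! ### Morphisms of fusion systems as functions -/

section SubgroupHom

variable {p : ℕ} {S S' : Type*} [Group S] [Group S']

/-- The homomorphism `H →* K` given by a function that is multiplicative on `H` and maps `H`
to `K`. It turns functions on the ambient group into morphisms between subgroups. -/
def homOfMulOn (H : Subgroup S) (K : Subgroup S') (f : S → S')
    (hmul : ∀ a ∈ H, ∀ b ∈ H, f (a * b) = f a * f b) (hf : ∀ a ∈ H, f a ∈ K) : H →* K :=
  MonoidHom.mk' (fun a => ⟨f a, hf a a.2⟩) fun a b => Subtype.ext (hmul a a.2 b b.2)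

theorem homOfMulOn_injective {H : Subgroup S} {K : Subgroup S'} {f : S → S'}
    (hmul : ∀ a ∈ H, ∀ b ∈ H, f (a * b) = f a * f b) (hf : ∀ a ∈ H, f a ∈ K)
    (hinj : Set.InjOn f H) : Function.Injective (homOfMulOn H K f hmul hf) :=
  fun a b hab => Subtype.ext (hinj a.2 b.2 (congrArg Subtype.val hab))

theorem IsPToral.toralOrder_le_of_injOn [Fact p.Prime] (hS : IsPToral p S') {H : Subgroup S}
    {K : Subgroup S'} {f : S → S'} (hmul : ∀ a ∈ H, ∀ b ∈ H, f (a * b) = f a * f b)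
    (hinj : Set.InjOn f H) (hf : ∀ a ∈ H, f a ∈ K) : toralOrder p H ≤ toralOrder p K :=
  (hS.subgroup K).toralOrder_le (homOfMulOn_injective hmul hf hinj)

theorem IsPToral.surjOn_of_toralOrder_le [Fact p.Prime] (hS : IsPToral p S') {H : Subgroup S}
    {K : Subgroup S'} {f : S → S'} (hmul : ∀ a ∈ H, ∀ b ∈ H, f (a * b) = f a * f b)
    (hinj : Set.InjOn f H) (hf : ∀ a ∈ H, f a ∈ K) (h : toralOrder p K ≤ toralOrder p H) :
    Set.SurjOn f H K := by
  intro b hb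
  obtain ⟨a, ha⟩ := (hS.subgroup K).surjective_of_toralOrder_le
    (homOfMulOn_injective hmul hf hinj) h ⟨b, hb⟩
  exact ⟨a, a.2, congrArg Subtype.val ha⟩

end SubgroupHom

section AutomorphismGroups

variable {S : Type*} [Group S] {P : Subgroup S}

theorem le_normalizer_of_forall_conj_mem {N : Subgroup S}
    (hN : ∀ n ∈ N, ∀ a ∈ P, n * a * n⁻¹ ∈ P) : N ≤ Subgroup.normalizer (P : Set S) := fun n hn =>
  Subgroup.mem_normalizer_iff.2 fun a =>
    ⟨hN n hn a, fun h => by simpa [mul_assoc] using hN _ (inv_mem hn) _ h⟩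

theorem mem_autBy_iff {α : MulAut P} :
    α ∈ autBy P ↔ ∃ g : S, ∀ a : P, (α a : S) = g * a * g⁻¹ := by
  refine ⟨fun ⟨g, hg⟩ => ⟨g, fun _ => hg ▸ rfl⟩, fun ⟨g, hg⟩ => ?_⟩
  have hgN : g ∈ Subgroup.normalizer (P : Set S) := by
    refine Subgroup.mem_normalizer_iff.2 fun a => ⟨fun ha => hg ⟨a, ha⟩ ▸ (α _).2, fun ha => ?_⟩
    obtain ⟨b, hb⟩ := α.surjective ⟨_, ha⟩
    have hab : g * a * g⁻¹ = g * b * g⁻¹ := by rw [← hg b, hb]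
    exact (mul_left_cancel (mul_right_cancel hab)) ▸ b.2
  exact ⟨⟨g, hgN⟩, MulEquiv.ext fun a => Subtype.ext (hg a).symm⟩

theorem mem_innerAut_iff {α : MulAut P} :
    α ∈ innerAut P ↔ ∃ g ∈ P, ∀ a : P, (α a : S) = g * a * g⁻¹ :=
  ⟨fun ⟨g, hg⟩ => ⟨g, g.2, fun _ => hg ▸ rfl⟩,
    fun ⟨g, hgP, hg⟩ => ⟨⟨g, hgP⟩, MulEquiv.ext fun a => Subtype.ext (hg a).symm⟩⟩

theorem innerAut_le_autBy : innerAut P ≤ autBy P := fun _ hα =>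
  let ⟨g, _, hg⟩ := mem_innerAut_iff.1 hα
  mem_autBy_iff.2 ⟨g, hg⟩

theorem isPGroup_autBy {p : ℕ} (hS : IsPGroup p S) (P : Subgroup S) : IsPGroup p (autBy P) :=
  (hS.to_subgroup _).of_surjective _ P.normalizerMonoidHom.rangeRestrict_surjective

/-- `N ≤ N_f`: each `n ∈ N` normalizes `P`, and `f c_n f⁻¹` is conjugation by some element of `S`.
This is the condition on `N` under which axiom (II) extends `f` from `P` to `N`; the element of `S`
is not required to normalize `f(P)`, which is automatic. -/
def LeExtensionDomain (f : S → S) (P N : Subgroup S) : Prop :=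
  ∀ n ∈ N, (∀ a ∈ P, n * a * n⁻¹ ∈ P) ∧ ∃ h : S, ∀ a ∈ P, f (n * a * n⁻¹) = h * f a * h⁻¹

theorem LeExtensionDomain.le_normalizer {f : S → S} {N : Subgroup S}
    (hN : LeExtensionDomain f P N) : N ≤ Subgroup.normalizer (P : Set S) :=
  le_normalizer_of_forall_conj_mem fun n hn => (hN n hn).1

end AutomorphismGroups

namespace FusionSystem

section Morphisms

variable {S : Type*} [Group S] (F : FusionSystem S)

/-- The restriction of `f` to `P` is a morphism of `F` from `P` to `S`. Morphisms are represented
by functions `S → S`, of which only the values on the source matter, so that restricting,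
composing and extending them involves no coercions between subgroups. -/
def IsMor (f : S → S) (P : Subgroup S) : Prop :=
  ∃ φ ∈ F.Hom P ⊤, ∀ a : P, (φ a : S) = f a

/-- The restriction of `f` to `P` is an isomorphism of `F` from `P` to `Q`, in the encoding of
`FusionSystem.IsMor`. -/
structure IsIso (f : S → S) (P Q : Subgroup S) : Prop where
  isMor : F.IsMor f P
  image_eq : f '' P = Q

theorem inclusion_mem {P Q : Subgroup S} (h : P ≤ Q) : Subgroup.inclusion h ∈ F.Hom P Q :=
  F.conj_mem _ ⟨1, fun a => by simp⟩

theorem isMor_conj (g : S) (P : Subgroup S) : F.IsMor (fun a => g * a * g⁻¹) P :=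
  ⟨homOfMulOn P ⊤ (fun a => g * a * g⁻¹) (fun a _ b _ => by simp [mul_assoc])
    fun _ _ => Subgroup.mem_top _, F.conj_mem _ ⟨g, fun _ => rfl⟩, fun _ => rfl⟩

variable {F} {f g : S → S} {P Q R : Subgroup S}

theorem IsMor.congr (hf : F.IsMor f P) (h : ∀ a ∈ P, g a = f a) : F.IsMor g P :=
  let ⟨φ, hφ, hφf⟩ := hf
  ⟨φ, hφ, fun a => (hφf a).trans (h a a.2).symm⟩

theorem IsMor.mono (hf : F.IsMor f P) (h : R ≤ P) : F.IsMor f R :=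
  let ⟨φ, hφ, hφf⟩ := hf
  ⟨φ.comp (Subgroup.inclusion h), F.comp_mem (F.inclusion_mem h) hφ, fun _ => hφf _⟩

theorem isMor_id (F : FusionSystem S) (P : Subgroup S) : F.IsMor id P :=
  (F.isMor_conj 1 P).congr fun a _ => by simp

theorem IsMor.map_mul (hf : F.IsMor f P) {a b : S} (ha : a ∈ P) (hb : b ∈ P) :
    f (a * b) = f a * f b := by
  obtain ⟨φ, -, hφ⟩ := hf
  simpa only [Subgroup.coe_mul, hφ] using
    congrArg Subtype.val (_root_.map_mul φ ⟨a, ha⟩ ⟨b, hb⟩)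

theorem IsMor.map_one (hf : F.IsMor f P) : f 1 = 1 := by
  simpa only [mul_one, left_eq_mul] using hf.map_mul P.one_mem P.one_mem

theorem IsMor.map_inv (hf : F.IsMor f P) {a : S} (ha : a ∈ P) : f a⁻¹ = (f a)⁻¹ := by
  rw [eq_inv_iff_mul_eq_one, ← hf.map_mul (inv_mem ha) ha, inv_mul_cancel, hf.map_one]

theorem IsMor.map_conj (hf : F.IsMor f P) {a b : S} (ha : a ∈ P) (hb : b ∈ P) :
    f (a * b * a⁻¹) = f a * f b * (f a)⁻¹ := by
  rw [hf.map_mul (mul_mem ha hb) (inv_mem ha), hf.map_mul ha hb, hf.map_inv ha]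

theorem IsMor.map_zpow (hf : F.IsMor f P) {a : S} (ha : a ∈ P) (k : ℤ) :
    f (a ^ k) = f a ^ k := by
  obtain ⟨φ, -, hφ⟩ := hf
  simpa only [Subgroup.coe_zpow, hφ] using congrArg Subtype.val (_root_.map_zpow φ ⟨a, ha⟩ k)

theorem IsMor.injOn (hf : F.IsMor f P) : Set.InjOn f P := by
  obtain ⟨φ, hφ, hφf⟩ := hf
  intro a ha b hb hab
  have hφab : φ ⟨a, ha⟩ = φ ⟨b, hb⟩ := Subtype.ext (by rw [hφf, hφf]; exact hab)
  exact congrArg Subtype.val (F.injective_of_mem hφ hφab)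

theorem IsIso.mem_iff (hf : F.IsIso f P Q) {b : S} : b ∈ Q ↔ ∃ a ∈ P, f a = b :=
  (Set.ext_iff.1 hf.image_eq b).symm

theorem IsIso.map_mem (hf : F.IsIso f P Q) {a : S} (ha : a ∈ P) : f a ∈ Q :=
  hf.mem_iff.2 ⟨a, ha, rfl⟩

theorem isIso_id (F : FusionSystem S) (P : Subgroup S) : F.IsIso id P P :=
  ⟨F.isMor_id P, Set.image_id _⟩

theorem IsMor.isIso_of_mulEquiv (hf : F.IsMor f P) (e : P ≃* Q) (he : ∀ a : P, (e a : S) = f a) :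
    F.IsIso f P Q := by
  refine ⟨hf, Set.ext fun b => ⟨?_, fun hb => ?_⟩⟩
  · rintro ⟨a, ha, rfl⟩
    exact he ⟨a, ha⟩ ▸ (e _).2
  · obtain ⟨a, ha⟩ := e.surjective ⟨b, hb⟩
    exact ⟨a, a.2, by rw [← he, ha]⟩

theorem coe_homImage_eq_image {φ : P →* Q} (hφ : ∀ a : P, (φ a : S) = f a) :
    (homImage φ : Set S) = f '' P := by
  ext b
  constructor
  · rintro ⟨_, ⟨a, rfl⟩, rfl⟩
    exact ⟨a, a.2, (hφ a).symm⟩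
  · rintro ⟨a, ha, rfl⟩
    exact ⟨φ ⟨a, ha⟩, ⟨_, rfl⟩, hφ _⟩

theorem IsMor.exists_isIso (hf : F.IsMor f P) : ∃ Q, F.IsIso f P Q :=
  let ⟨_, _, hφf⟩ := id hf
  ⟨_, hf, (coe_homImage_eq_image hφf).symm⟩

theorem IsIso.homImage_eq (hf : F.IsIso f P Q) {φ : P →* R} (hφ : ∀ a : P, (φ a : S) = f a) :
    homImage φ = Q :=
  SetLike.coe_injective ((coe_homImage_eq_image hφ).trans hf.image_eq)

theorem exists_isMor_of_mem_hom {φ : P →* Q} (hφ : φ ∈ F.Hom P Q) :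
    ∃ f, F.IsMor f P ∧ ∀ a : P, f a = φ a := by
  classical
  refine ⟨fun s => if h : s ∈ P then φ ⟨s, h⟩ else 1,
    ⟨(Subgroup.inclusion le_top).comp φ, F.comp_mem hφ (F.inclusion_mem _), fun a => ?_⟩,
    fun a => ?_⟩ <;> simp

theorem IsIso.exists_mulEquiv (hf : F.IsIso f P Q) :
    ∃ e : P ≃* Q, e.toMonoidHom ∈ F.Hom P Q ∧ e.symm.toMonoidHom ∈ F.Hom Q P ∧
      ∀ a : P, (e a : S) = f a := by
  obtain ⟨φ, hφ, hφf⟩ := hf.isMor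
  obtain ⟨R, hR, e, he, he', rfl⟩ := F.factor hφ
  obtain rfl : R = Q :=
    SetLike.coe_injective ((hf.isMor.isIso_of_mulEquiv e hφf).image_eq.symm.trans hf.image_eq)
  exact ⟨e, he, he', hφf⟩

theorem IsIso.exists_symm (hf : F.IsIso f P Q) :
    ∃ g, F.IsIso g Q P ∧ (∀ a ∈ P, g (f a) = a) ∧ ∀ b ∈ Q, f (g b) = b := by
  obtain ⟨e, -, he', hef⟩ := hf.exists_mulEquiv
  obtain ⟨g, hg, hge⟩ := exists_isMor_of_mem_hom he'
  refine ⟨g, hg.isIso_of_mulEquiv e.symm fun b => (hge b).symm, fun a ha => ?_, fun b hb => ?_⟩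
  · rw [← hef ⟨a, ha⟩, hge]
    exact congrArg Subtype.val (e.symm_apply_apply ⟨a, ha⟩)
  · rw [hge ⟨b, hb⟩]
    exact (hef _).symm.trans (congrArg Subtype.val (e.apply_symm_apply ⟨b, hb⟩))

theorem IsMor.comp (hf : F.IsMor f P) (hg : F.IsMor g Q) (h : ∀ a ∈ P, f a ∈ Q) :
    F.IsMor (fun a => g (f a)) P := by
  obtain ⟨R, hR⟩ := hf.exists_isIso
  have hRQ : R ≤ Q := fun b hb => by
    obtain ⟨a, ha, rfl⟩ := hR.mem_iff.1 hb
    exact h a ha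
  obtain ⟨e, he, -, hef⟩ := hR.exists_mulEquiv
  obtain ⟨φ, hφ, hφg⟩ := hg.mono hRQ
  exact ⟨φ.comp e.toMonoidHom, F.comp_mem he hφ, fun a => (hφg (e a)).trans (by rw [hef])⟩

theorem IsIso.trans (hf : F.IsIso f P Q) (hg : F.IsIso g Q R) :
    F.IsIso (fun a => g (f a)) P R :=
  ⟨hf.isMor.comp hg.isMor fun _ ha => hf.map_mem ha, by
    rw [← hg.image_eq, ← hf.image_eq, Set.image_image]⟩

theorem IsIso.congr (hf : F.IsIso f P Q) (h : ∀ a ∈ P, g a = f a) : F.IsIso g P Q :=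
  ⟨hf.isMor.congr h, (Set.image_congr h).trans hf.image_eq⟩

theorem IsMor.mem_hom (hf : F.IsMor f P) (φ : P →* Q) (h : ∀ a : P, (φ a : S) = f a) :
    φ ∈ F.Hom P Q := by
  obtain ⟨R, hR⟩ := hf.exists_isIso
  obtain ⟨e, he, -, hef⟩ := hR.exists_mulEquiv
  have hRQ : R ≤ Q := fun b hb => by
    obtain ⟨a, ha, rfl⟩ := hR.mem_iff.1 hb
    exact h ⟨a, ha⟩ ▸ (φ _).2
  have hφ : φ = (Subgroup.inclusion hRQ).comp e.toMonoidHom :=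
    MonoidHom.ext fun a => Subtype.ext ((h a).trans (hef a).symm)
  exact hφ ▸ F.comp_mem he (F.inclusion_mem hRQ)

theorem isConjugate_iff : F.IsConjugate P Q ↔ ∃ f, F.IsIso f P Q := by
  constructor
  · rintro ⟨e, he, -⟩
    obtain ⟨f, hf, hfe⟩ := exists_isMor_of_mem_hom he
    exact ⟨f, hf.isIso_of_mulEquiv e fun a => (hfe a).symm⟩
  · rintro ⟨f, hf⟩
    obtain ⟨e, he, he', -⟩ := hf.exists_mulEquiv
    exact ⟨e, he, he'⟩

theorem exists_isIso_of_mem_aut {α : MulAut P} (hα : α ∈ F.aut P) :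
    ∃ u, F.IsIso u P P ∧ ∀ a : P, (α a : S) = u a := by
  obtain ⟨u, hu, huα⟩ := exists_isMor_of_mem_hom hα.1
  exact ⟨u, hu.isIso_of_mulEquiv α fun a => (huα a).symm, fun a => (huα a).symm⟩

theorem mem_aut_iff {α : MulAut P} :
    α ∈ F.aut P ↔ ∃ f, F.IsMor f P ∧ ∀ a : P, (α a : S) = f a := by
  refine ⟨fun hα => let ⟨u, hu, hαu⟩ := exists_isIso_of_mem_aut hα; ⟨u, hu.isMor, hαu⟩, ?_⟩
  rintro ⟨f, hf, hαf⟩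
  obtain ⟨g, hg, hgf, -⟩ := (hf.isIso_of_mulEquiv α hαf).exists_symm
  refine ⟨hf.mem_hom _ hαf, hg.isMor.mem_hom _ fun a => ?_⟩
  obtain ⟨b, rfl⟩ := α.surjective a
  rw [hαf, hgf b b.2]
  exact congrArg Subtype.val (α.symm_apply_apply b)

theorem autBy_le_aut : autBy P ≤ F.aut P := fun _ hα =>
  let ⟨g, hg⟩ := mem_autBy_iff.1 hα
  mem_aut_iff.2 ⟨_, F.isMor_conj g P, hg⟩

theorem IsConjugateElement.trans {x y z : S} (hxy : F.IsConjugateElement x y)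
    (hyz : F.IsConjugateElement y z) : F.IsConjugateElement x z := by
  obtain ⟨φ, hφ, hφx⟩ := hxy
  obtain ⟨ψ, hψ, hψy⟩ := hyz
  refine ⟨ψ.comp φ, F.comp_mem hφ hψ, ?_⟩
  rw [MonoidHom.comp_apply, Subtype.ext (a2 := ⟨y, Subgroup.mem_zpowers y⟩) hφx, hψy]

theorem isConjugateElement_iff {x y : S} :
    F.IsConjugateElement x y ↔ ∃ f, F.IsMor f (Subgroup.zpowers x) ∧ f x = y := by
  constructor
  · rintro ⟨φ, hφ, h⟩
    obtain ⟨f, hf, hfφ⟩ := exists_isMor_of_mem_hom hφ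
    exact ⟨f, hf, (hfφ ⟨x, Subgroup.mem_zpowers x⟩).trans h⟩
  · rintro ⟨f, hf, rfl⟩
    have hmem : ∀ a ∈ Subgroup.zpowers x, f a ∈ Subgroup.zpowers (f x) := by
      rintro _ ⟨k, rfl⟩
      exact ⟨k, (hf.map_zpow (Subgroup.mem_zpowers x) k).symm⟩
    exact ⟨homOfMulOn _ _ f (fun a ha b hb => hf.map_mul ha hb) hmem,
      hf.mem_hom _ fun a => rfl, rfl⟩

theorem IsMor.isConjugateElement {x : S} (hf : F.IsMor f P) (hx : x ∈ P) :
    F.IsConjugateElement x (f x) :=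
  isConjugateElement_iff.2 ⟨f, hf.mono (Subgroup.zpowers_le.2 hx), rfl⟩

end Morphisms

section Axioms

variable {p : ℕ} {S : Type*} [Group S] {F : FusionSystem S} {f : S → S} {P Q : Subgroup S}

theorem fullyCentralized_iff : F.FullyCentralized p P ↔ ∀ f Q, F.IsIso f P Q →
    toralOrder p (Subgroup.centralizer (Q : Set S)) ≤
      toralOrder p (Subgroup.centralizer (P : Set S)) :=
  ⟨fun h f Q hf => h Q (isConjugate_iff.2 ⟨f, hf⟩),
    fun h Q hQ => let ⟨f, hf⟩ := isConjugate_iff.1 hQ; h f Q hf⟩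

theorem fullyNormalized_iff : F.FullyNormalized p P ↔ ∀ f Q, F.IsIso f P Q →
    toralOrder p (Subgroup.normalizer (Q : Set S)) ≤
      toralOrder p (Subgroup.normalizer (P : Set S)) :=
  ⟨fun h f Q hf => h Q (isConjugate_iff.2 ⟨f, hf⟩),
    fun h Q hQ => let ⟨f, hf⟩ := isConjugate_iff.1 hQ; h f Q hf⟩

theorem FullyCentralized.of_isIso (hP : F.FullyCentralized p P) (hf : F.IsIso f P Q)
    (h : toralOrder p (Subgroup.centralizer (P : Set S)) ≤
      toralOrder p (Subgroup.centralizer (Q : Set S))) : F.FullyCentralized p Q :=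
  fullyCentralized_iff.2 fun _ R hg => (fullyCentralized_iff.1 hP _ R (hf.trans hg)).trans h

theorem FullyNormalized.of_isIso (hP : F.FullyNormalized p P) (hf : F.IsIso f P Q)
    (h : toralOrder p (Subgroup.normalizer (P : Set S)) ≤
      toralOrder p (Subgroup.normalizer (Q : Set S))) : F.FullyNormalized p Q :=
  fullyNormalized_iff.2 fun _ R hg => (fullyNormalized_iff.1 hP _ R (hf.trans hg)).trans h

theorem IsIso.mem_normalizer_of_map_conj (hf : F.IsIso f P Q) {n h : S}
    (hn : n ∈ Subgroup.normalizer (P : Set S))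
    (hh : ∀ a ∈ P, f (n * a * n⁻¹) = h * f a * h⁻¹) : h ∈ Subgroup.normalizer (Q : Set S) := by
  rw [Subgroup.mem_normalizer_iff] at hn
  refine Subgroup.mem_normalizer_iff.2 fun b => ⟨fun hb => ?_, fun hb => ?_⟩
  · obtain ⟨a, ha, rfl⟩ := hf.mem_iff.1 hb
    exact hh a ha ▸ hf.map_mem ((hn a).1 ha)
  · obtain ⟨a, ha, hab⟩ := hf.mem_iff.1 hb
    have hconj : n * (n⁻¹ * a * n) * n⁻¹ = a := by group
    have ha' : n⁻¹ * a * n ∈ P := (hn _).2 (by rwa [hconj])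
    have hfa := hh _ ha'
    rw [hconj, hab] at hfa
    exact mul_left_cancel (mul_right_cancel hfa) ▸ hf.map_mem ha'

theorem IsIso.mem_extensionDomain_iff (hf : F.IsIso f P Q) {φ : P →* (⊤ : Subgroup S)}
    (hφ : ∀ a : P, (φ a : S) = f a) {n : S} :
    n ∈ extensionDomain φ ↔ n ∈ Subgroup.normalizer (P : Set S) ∧
      ∃ h : S, ∀ a ∈ P, f (n * a * n⁻¹) = h * f a * h⁻¹ := by
  refine and_congr_right fun hn => ⟨fun ⟨h, _, hh⟩ => ⟨h, fun a ha => ?_⟩, fun ⟨h, hh⟩ =>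
    ⟨h, ?_, fun a b hab => ?_⟩⟩
  · simpa only [hφ] using hh ⟨a, ha⟩ ⟨_, (Subgroup.mem_normalizer_iff.1 hn a).1 ha⟩ rfl
  · rw [hf.homImage_eq hφ]
    exact hf.mem_normalizer_of_map_conj hn hh
  · rw [hφ, hφ, hab]
    exact hh a a.2

theorem extensionAxiom_iff : F.ExtensionAxiom p ↔
    ∀ (f : S → S) (P Q N : Subgroup S), F.IsIso f P Q → F.FullyCentralized p Q → P ≤ N →
      LeExtensionDomain f P N → ∃ g, F.IsMor g N ∧ ∀ a ∈ P, g a = f a := by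
  constructor
  · intro H f P Q N hf hQ _ hN
    obtain ⟨φ, hφ, hφf⟩ := hf.isMor
    obtain ⟨ψ, hψ, hψφ⟩ := H P φ hφ ((hf.homImage_eq hφf).symm ▸ hQ)
    obtain ⟨g, hg, hgψ⟩ := exists_isMor_of_mem_hom hψ
    have hNφ : N ≤ extensionDomain φ := fun n hn => (hf.mem_extensionDomain_iff hφf).2
      ⟨hN.le_normalizer hn, (hN n hn).2⟩
    refine ⟨g, hg.mono hNφ, fun a ha => ?_⟩
    rw [hgψ ⟨a, le_extensionDomain φ ha⟩, ← hφf ⟨a, ha⟩]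
    exact congrArg Subtype.val (DFunLike.congr_fun hψφ ⟨a, ha⟩)
  · intro H P φ hφ hQ
    obtain ⟨f, hf, hfφ⟩ := exists_isMor_of_mem_hom hφ
    obtain ⟨Q, hfQ⟩ := hf.exists_isIso
    have hφf : ∀ a : P, (φ a : S) = f a := fun a => (hfφ a).symm
    obtain ⟨g, ⟨ψ, hψ, hψg⟩, hgf⟩ := H f P Q (extensionDomain φ) hfQ
      (hfQ.homImage_eq hφf ▸ hQ) (le_extensionDomain φ) fun n hn =>
        let ⟨hnP, hnf⟩ := (hfQ.mem_extensionDomain_iff hφf).1 hn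
        ⟨fun a ha => (Subgroup.mem_normalizer_iff.1 hnP a).1 ha, hnf⟩
    refine ⟨ψ, hψ, MonoidHom.ext fun a => Subtype.ext ?_⟩
    rw [hφf, ← hgf a a.2]
    exact hψg (Subgroup.inclusion (le_extensionDomain φ) a)

theorem continuityAxiom_iff : F.ContinuityAxiom ↔ ∀ (P : ℕ → Subgroup S), Monotone P →
    ∀ f : S → S, (∀ n, F.IsMor f (P n)) → F.IsMor f (⨆ n, P n) := by
  constructor
  · intro H P hP f hf
    have hmul : ∀ a ∈ ⨆ n, P n, ∀ b ∈ ⨆ n, P n, f (a * b) = f a * f b := by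
      intro a ha b hb
      obtain ⟨i, hi⟩ := (Subgroup.mem_iSup_of_directed hP.directed_le).1 ha
      obtain ⟨j, hj⟩ := (Subgroup.mem_iSup_of_directed hP.directed_le).1 hb
      exact (hf (max i j)).map_mul (hP (le_max_left i j) hi) (hP (le_max_right i j) hj)
    exact ⟨homOfMulOn _ ⊤ f hmul fun _ _ => Subgroup.mem_top _,
      H P hP _ fun n => (hf n).mem_hom _ fun a => rfl, fun a => rfl⟩
  · intro H P hP φ hφ
    classical
    let f : S → S := fun s => if h : s ∈ ⨆ n, P n then φ ⟨s, h⟩ else 1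
    have hφf : ∀ a : (⨆ n, P n : Subgroup S), (φ a : S) = f a := fun a => by simp [f]
    refine (H P hP f fun n => ⟨_, hφ n, fun a => ?_⟩).mem_hom φ hφf
    exact hφf (Subgroup.inclusion (le_iSup P n) a)

/-- `Out_F(P)` is finite and `Aut_S(P)` has index prime to `p` in `Aut_F(P)`. For a `p`-group `S`
this is the condition of axiom (I) that `Out_S(P)` be a Sylow `p`-subgroup of the finite group
`Out_F(P)`, phrased without quotients. -/
def HasSylowAut (p : ℕ) (F : FusionSystem S) (P : Subgroup S) : Prop :=
  (innerAut P).relIndex (F.aut P) ≠ 0 ∧ ¬ p ∣ (autBy P).relIndex (F.aut P)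

theorem card_out : Nat.card (F.out P) = (innerAut P).relIndex (F.aut P) := by
  conv_rhs => rw [← QuotientGroup.ker_mk' (innerAut P)]
  exact (Subgroup.relIndex_ker _ _).symm

theorem relIndex_outBy_out : (outBy P).relIndex (F.out P) = (autBy P).relIndex (F.aut P) := by
  rw [outBy, out, Subgroup.relIndex_map_map, QuotientGroup.ker_mk', sup_eq_left.2 innerAut_le_autBy,
    sup_eq_left.2 (innerAut_le_autBy.trans autBy_le_aut)]

theorem hasSylowAut_iff [Fact p.Prime] (hS : IsPGroup p S) :
    F.HasSylowAut p P ↔ Finite (F.out P) ∧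
      ∃ R : Sylow p (F.out P), (R : Subgroup (F.out P)) = (outBy P).subgroupOf (F.out P) := by
  have hp : IsPGroup p ((outBy P).subgroupOf (F.out P)) :=
    ((isPGroup_autBy hS P).map _).of_injective
      ((Subgroup.subgroupOfEquivOfLe (Subgroup.map_mono autBy_le_aut)).toMonoidHom)
      (MulEquiv.injective _)
  rw [HasSylowAut, ← card_out, ← relIndex_outBy_out]
  constructor
  · rintro ⟨hcard, hindex⟩
    have hfin : Finite (F.out P) := Nat.finite_of_card_ne_zero hcard
    exact ⟨hfin, hp.toSylow hindex, rfl⟩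
  · rintro ⟨hfin, R, hR⟩
    refine ⟨Nat.card_pos.ne', ?_⟩
    rw [Subgroup.relIndex, ← hR]
    exact R.not_dvd_index

theorem sylowAxiom_iff [Fact p.Prime] (hS : IsPGroup p S) : F.SylowAxiom p ↔
    ∀ P : Subgroup S, F.FullyNormalized p P → F.FullyCentralized p P ∧ F.HasSylowAut p P :=
  forall₂_congr fun _ _ => and_congr_right fun _ => (hasSylowAut_iff hS).symm

theorem IsIso.toralOrder_eq [Fact p.Prime] (hS : IsPToral p S) (hf : F.IsIso f P Q) :
    toralOrder p P = toralOrder p Q :=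
  let ⟨e, _⟩ := hf.exists_mulEquiv
  le_antisymm ((hS.subgroup Q).toralOrder_le (f := e.toMonoidHom) e.injective)
    ((hS.subgroup P).toralOrder_le (f := e.symm.toMonoidHom) e.symm.injective)

theorem exists_fullyNormalized [Fact p.Prime] (hS : IsPToral p S) (F : FusionSystem S)
    (P : Subgroup S) : ∃ f Q, F.IsIso f P Q ∧ F.FullyNormalized p Q := by
  obtain ⟨B, hB⟩ := hS.exists_index_normalizer_le (identityComponent P).index
  let orders : Set (ℕ ×ₗ ℕ) := {o | ∃ f Q, F.IsIso f P Q ∧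
    toralOrder p (Subgroup.normalizer (Q : Set S)) = o}
  have hfin : orders.Finite := by
    refine (((Set.finite_Iic (toralRank p S)).prod (Set.finite_Iic B)).preimage
      (f := (ofLex : ℕ ×ₗ ℕ → ℕ × ℕ)) ofLex.injective.injOn).subset ?_
    rintro _ ⟨f, Q, hf, rfl⟩
    exact ⟨hS.toralRank_le (Subgroup.subtype_injective _),
      hB Q (congrArg (fun o => (ofLex o).2) (hf.toralOrder_eq hS).symm)⟩
  obtain ⟨_, ⟨f, Q, hf, rfl⟩, hmax⟩ :=
    Set.exists_max_image orders id hfin ⟨_, id, P, F.isIso_id P, rfl⟩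
  exact ⟨f, Q, hf, fullyNormalized_iff.2 fun g R hg => hmax _ ⟨_, R, hf.trans hg, rfl⟩⟩

end Axioms

end FusionSystem

/-! ### Transport along isomorphisms -/

theorem mulAut_congr_conj {G G' : Type*} [Group G] [Group G'] (e : G ≃* G') (a : G) :
    MulAut.congr e (MulAut.conj a) = MulAut.conj (e a) := by
  ext b
  change e (a * e.symm b * a⁻¹) = e a * b * (e a)⁻¹
  simp

theorem comap_innerAut_congr {G G' : Type*} [Group G] [Group G'] (e : G ≃* G') :
    (innerAut G').comap (MulAut.congr e).toMonoidHom = innerAut G := by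
  ext α
  constructor
  · rintro ⟨a, ha⟩
    refine ⟨e.symm a, (MulAut.congr e).injective ?_⟩
    rw [mulAut_congr_conj, e.apply_symm_apply]
    exact ha
  · rintro ⟨a, rfl⟩
    exact ⟨e a, (mulAut_congr_conj e a).symm⟩

theorem comap_stabilizer_congr {G G' : Type*} [Group G] [Group G'] (e : G ≃* G') (a : G) :
    (MulAction.stabilizer (MulAut G') (e a)).comap (MulAut.congr e).toMonoidHom =
      MulAction.stabilizer (MulAut G) a := by
  ext α
  change e (α (e.symm (e a))) = e a ↔ α a = a
  rw [e.symm_apply_apply, e.injective.eq_iff]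

namespace FusionSystem

section Transport

variable {p : ℕ} {S : Type*} [Group S] {F : FusionSystem S} {f g ρ : S → S}
  {D P Q R : Subgroup S}

theorem IsMor.map_mem_centralizer (hρ : F.IsMor ρ D) (hPD : P ≤ D) (hPQ : F.IsIso ρ P Q) {c : S}
    (hcD : c ∈ D) (hc : c ∈ Subgroup.centralizer (P : Set S)) :
    ρ c ∈ Subgroup.centralizer (Q : Set S) := by
  refine Subgroup.mem_centralizer_iff.2 fun b hb => ?_
  obtain ⟨a, ha, rfl⟩ := hPQ.mem_iff.1 hb
  rw [← hρ.map_mul (hPD ha) hcD, ← hρ.map_mul hcD (hPD ha),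
    Subgroup.mem_centralizer_iff.1 hc a ha]

theorem IsMor.map_mem_normalizer (hρ : F.IsMor ρ D) (hPD : P ≤ D) (hPQ : F.IsIso ρ P Q) {n : S}
    (hnD : n ∈ D) (hn : n ∈ Subgroup.normalizer (P : Set S)) :
    ρ n ∈ Subgroup.normalizer (Q : Set S) :=
  hPQ.mem_normalizer_of_map_conj hn fun _ ha => hρ.map_conj hnD (hPD ha)

theorem IsMor.toralOrder_centralizer_le [Fact p.Prime] (hS : IsPToral p S) (hρ : F.IsMor ρ D)
    (hPD : P ≤ D) (hCD : Subgroup.centralizer (P : Set S) ≤ D) (hPQ : F.IsIso ρ P Q) :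
    toralOrder p (Subgroup.centralizer (P : Set S)) ≤
      toralOrder p (Subgroup.centralizer (Q : Set S)) :=
  hS.toralOrder_le_of_injOn (fun _ ha _ hb => hρ.map_mul (hCD ha) (hCD hb))
    (hρ.injOn.mono hCD) fun _ hc => hρ.map_mem_centralizer hPD hPQ (hCD hc) hc

theorem FullyNormalized.isIso_normalizer [Fact p.Prime] (hS : IsPToral p S)
    (hP : F.FullyNormalized p P) (hρ : F.IsMor ρ D)
    (hND : Subgroup.normalizer (P : Set S) ≤ D) (hPQ : F.IsIso ρ P Q) :
    F.IsIso ρ (Subgroup.normalizer (P : Set S)) (Subgroup.normalizer (Q : Set S)) := by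
  have hmem : ∀ n ∈ Subgroup.normalizer (P : Set S), ρ n ∈ Subgroup.normalizer (Q : Set S) :=
    fun n hn => hρ.map_mem_normalizer (Subgroup.le_normalizer.trans hND) hPQ (hND hn) hn
  have hsurj := hS.surjOn_of_toralOrder_le (fun a ha b hb => hρ.map_mul (hND ha) (hND hb))
    (hρ.injOn.mono hND) hmem (fullyNormalized_iff.1 hP _ _ hPQ)
  exact ⟨hρ.mono hND, hsurj.image_eq_of_mapsTo hmem⟩

theorem IsIso.of_leftInvOn (hf : F.IsIso f P Q) (hg : F.IsMor g Q) (hgf : ∀ a ∈ P, g (f a) = a) :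
    F.IsIso g Q P :=
  ⟨hg, by rw [← hf.image_eq, Set.image_image, Set.image_congr hgf, Set.image_id']⟩

theorem map_aut_congr_le (e : P ≃* Q) (hf : F.IsIso f P Q) (he : ∀ a : P, (e a : S) = f a) :
    (F.aut P).map (MulAut.congr e).toMonoidHom ≤ F.aut Q := by
  rintro _ ⟨α, hα, rfl⟩
  obtain ⟨g, hg, hgf, -⟩ := hf.exists_symm
  obtain ⟨u, hu, hαu⟩ := exists_isIso_of_mem_aut hα
  refine mem_aut_iff.2 ⟨_, ((hg.trans hu).trans hf).isMor, fun b => ?_⟩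
  obtain ⟨a, rfl⟩ := e.surjective b
  change ((e (α (e.symm (e a))) : Q) : S) = _
  rw [e.symm_apply_apply, he, hαu, he, hgf a a.2]

theorem map_aut_congr (e : P ≃* Q) (hf : F.IsIso f P Q) (he : ∀ a : P, (e a : S) = f a) :
    (F.aut P).map (MulAut.congr e).toMonoidHom = F.aut Q := by
  refine (map_aut_congr_le e hf he).antisymm fun β hβ => ?_
  obtain ⟨g, hg, hgf, -⟩ := hf.exists_symm
  have heg : ∀ b : Q, (e.symm b : S) = g b := fun b => by
    obtain ⟨a, rfl⟩ := e.surjective b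
    rw [he, hgf a a.2, e.symm_apply_apply]
  exact ⟨_, map_aut_congr_le e.symm hg heg ⟨β, hβ, rfl⟩, (MulAut.congr e).apply_symm_apply β⟩

theorem relIndex_aut_congr (e : P ≃* Q) (hf : F.IsIso f P Q) (he : ∀ a : P, (e a : S) = f a)
    (A : Subgroup (MulAut Q)) :
    A.relIndex (F.aut Q) = (A.comap (MulAut.congr e).toMonoidHom).relIndex (F.aut P) := by
  rw [Subgroup.relIndex_comap, map_aut_congr e hf he]

theorem comap_autBy_congr (e : P ≃* Q) (he : ∀ a : P, (e a : S) = g a)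
    (hN : F.IsIso g (Subgroup.normalizer (P : Set S)) (Subgroup.normalizer (Q : Set S))) :
    (autBy Q).comap (MulAut.congr e).toMonoidHom = autBy P := by
  have hP : P ≤ Subgroup.normalizer (P : Set S) := Subgroup.le_normalizer
  ext α
  constructor
  · rintro ⟨⟨m, hm⟩, hmα⟩
    obtain ⟨n, hn, rfl⟩ := hN.mem_iff.1 hm
    refine mem_autBy_iff.2 ⟨n, fun a => hN.isMor.injOn (hP (α a).2)
      (mul_mem (mul_mem hn (hP a.2)) (inv_mem hn)) ?_⟩
    have hconj : g n * (e a : S) * (g n)⁻¹ = (e (α (e.symm (e a))) : Q) :=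
      congrArg Subtype.val (DFunLike.congr_fun hmα (e a))
    rw [hN.isMor.map_conj hn (hP a.2), ← he, ← he, hconj, e.symm_apply_apply]
  · rintro ⟨n, rfl⟩
    refine mem_autBy_iff.2 ⟨g n, fun b => ?_⟩
    obtain ⟨a, rfl⟩ := e.surjective b
    change ((e (P.normalizerMonoidHom n (e.symm (e a))) : Q) : S) = _
    rw [e.symm_apply_apply, he, he, ← hN.isMor.map_conj n.2 (hP a.2)]
    rfl

theorem FullyCentralized.of_isIso_normalizer [Fact p.Prime] (hS : IsPToral p S)
    (hN : F.IsIso g (Subgroup.normalizer (P : Set S)) (Subgroup.normalizer (Q : Set S)))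
    (hg : F.IsIso g P Q) (hQ : F.FullyCentralized p Q) : F.FullyCentralized p P := by
  obtain ⟨k, hk, hkg, -⟩ := hN.exists_symm
  have hkQP : F.IsIso k Q P := hg.of_leftInvOn (hk.isMor.mono Subgroup.le_normalizer)
    fun a ha => hkg a (Subgroup.le_normalizer ha)
  exact hQ.of_isIso hkQP (hk.isMor.toralOrder_centralizer_le hS Subgroup.le_normalizer
    (Subgroup.centralizer_le_normalizer _) hkQP)

theorem HasSylowAut.of_isIso_normalizer
    (hN : F.IsIso g (Subgroup.normalizer (P : Set S)) (Subgroup.normalizer (Q : Set S)))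
    (hg : F.IsIso g P Q) (hQ : F.HasSylowAut p Q) : F.HasSylowAut p P := by
  obtain ⟨e, -, -, he⟩ := hg.exists_mulEquiv
  rwa [HasSylowAut, relIndex_aut_congr e hg he, relIndex_aut_congr e hg he, comap_innerAut_congr,
    comap_autBy_congr e he hN] at hQ

theorem HasSylowAut.exists_isIso_not_dvd_index {L : Type*} [Group L] (hQ : F.HasSylowAut p Q)
    (hf : F.IsIso f P Q) {u : L →* MulAut P} (hu : u.range ≤ F.aut P) :
    ∃ (g : S → S) (e : P ≃* Q), F.IsIso g P Q ∧ (∀ a : P, (e a : S) = g a) ∧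
      ¬ p ∣ ((autBy Q).comap ((MulAut.congr e).toMonoidHom.comp u)).index := by
  obtain ⟨e, -, -, he⟩ := hf.exists_mulEquiv
  obtain ⟨γ, hγ, hindex⟩ := exists_conj_not_dvd_index ((MulAut.congr e).toMonoidHom.comp u)
    (by rw [MonoidHom.range_comp]; exact (Subgroup.map_mono hu).trans (map_aut_congr_le e hf he))
    hQ.2
  obtain ⟨v, hv, hγv⟩ := exists_isIso_of_mem_aut (inv_mem hγ)
  refine ⟨_, e.trans γ⁻¹, hf.trans hv, fun a => (hγv (e a)).trans (congrArg v (he a)), ?_⟩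
  have hcomp : (MulAut.congr (e.trans γ⁻¹)).toMonoidHom.comp u =
      (MulAut.conj γ⁻¹).toMonoidHom.comp ((MulAut.congr e).toMonoidHom.comp u) := rfl
  rwa [hcomp, ← Subgroup.comap_comap]

theorem HasSylowAut.exists_isIso_map_conj (hS : IsPGroup p S) [Fact p.Prime]
    (hQ : F.HasSylowAut p Q) (hf : F.IsIso f P Q) :
    ∃ u, F.IsIso u Q Q ∧ ∀ n ∈ Subgroup.normalizer (P : Set S),
      ∃ h : S, ∀ a ∈ P, u (f (n * a * n⁻¹)) = h * u (f a) * h⁻¹ := by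
  obtain ⟨e, -, -, he⟩ := hf.exists_mulEquiv
  -- `Aut_S(Q)` has index prime to `p` in `Aut_F(Q)`, so it contains a conjugate of the `p`-group
  -- `f Aut_S(P) f⁻¹`.
  obtain ⟨γ, hγ, hγA⟩ := exists_conj_le_of_isPGroup
    ((isPGroup_autBy hS P).map (MulAut.congr e).toMonoidHom)
    ((Subgroup.map_mono autBy_le_aut).trans (map_aut_congr_le e hf he)) hQ.2
  obtain ⟨u, hu, hγu⟩ := exists_isIso_of_mem_aut (inv_mem hγ)
  refine ⟨u, hu, fun n hn => ?_⟩
  let c : MulAut P := P.normalizerMonoidHom ⟨n, hn⟩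
  obtain ⟨h, hh⟩ := mem_autBy_iff.1 (hγA _ ⟨c, ⟨_, rfl⟩, rfl⟩)
  refine ⟨h, fun a ha => ?_⟩
  have hconj : (γ⁻¹ * (MulAut.congr e).toMonoidHom c * γ) (γ⁻¹ (e ⟨a, ha⟩)) =
      γ⁻¹ (e (c ⟨a, ha⟩)) := by
    change γ⁻¹ (e (c (e.symm (γ (γ⁻¹ (e ⟨a, ha⟩)))))) = _
    rw [MulAut.apply_inv_self, e.symm_apply_apply]
  have hval := hh (γ⁻¹ (e ⟨a, ha⟩))
  rw [hconj, hγu, hγu, he, he] at hval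
  exact hval

theorem FullyNormalized.fullyCentralized_and_hasSylowAut [Fact p.Prime] (hS : IsPToral p S)
    (hF : F.ExtensionAxiom p) (hP : F.FullyNormalized p P) (hf : F.IsIso f P Q)
    (hQ : F.FullyCentralized p Q) (hQ' : F.HasSylowAut p Q) :
    F.FullyCentralized p P ∧ F.HasSylowAut p P := by
  obtain ⟨u, hu, hconj⟩ := hQ'.exists_isIso_map_conj hS.isPGroup hf
  obtain ⟨g, hg, hgf⟩ := extensionAxiom_iff.1 hF _ P Q _ (hf.trans hu) hQ Subgroup.le_normalizer
    fun n hn => ⟨fun a ha => (Subgroup.mem_normalizer_iff.1 hn a).1 ha, hconj n hn⟩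
  have hgPQ : F.IsIso g P Q := (hf.trans hu).congr hgf
  have hN := hP.isIso_normalizer hS hg le_rfl hgPQ
  exact ⟨hQ.of_isIso_normalizer hS hN hgPQ, hQ'.of_isIso_normalizer hN hgPQ⟩

end Transport

/-! ### Centralizer fusion systems -/

section Centralizer

variable {p : ℕ} {S : Type*} [Group S] {F : FusionSystem S} {x : S}

open Classical in
/-- The retraction of `S` onto `C_S(x)` which is `1` outside `C_S(x)`. It turns functions on `S`
into functions on `C_S(x)`, as the encoding of morphisms of `C_F(x)` requires. -/
noncomputable def toCentralizer (x s : S) : elemCentralizer x :=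
  if h : s ∈ elemCentralizer x then ⟨s, h⟩ else 1

theorem coe_toCentralizer {s : S} (h : s ∈ elemCentralizer x) : (toCentralizer x s : S) = s := by
  rw [toCentralizer, dif_pos h]

theorem toCentralizer_coe (s : elemCentralizer x) : toCentralizer x s = s :=
  Subtype.ext (coe_toCentralizer s.2)

theorem toCentralizer_mul {s t : S} (hs : s ∈ elemCentralizer x) (ht : t ∈ elemCentralizer x) :
    toCentralizer x (s * t) = toCentralizer x s * toCentralizer x t :=
  Subtype.ext (by
    rw [Subgroup.coe_mul, coe_toCentralizer hs, coe_toCentralizer ht,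
      coe_toCentralizer (mul_mem hs ht)])

theorem toCentralizer_injOn {A : Set S} (hA : ∀ s ∈ A, s ∈ elemCentralizer x) :
    Set.InjOn (toCentralizer x) A := fun a ha b hb hab => by
  rw [← coe_toCentralizer (hA a ha), hab, coe_toCentralizer (hA b hb)]

theorem mem_elemCentralizer_iff_conj_eq {s : S} : s ∈ elemCentralizer x ↔ s * x * s⁻¹ = x :=
  Subgroup.mem_centralizer_singleton_iff.trans mul_inv_eq_iff_eq_mul.symm

theorem commute_zpow_of_elemCentralizer (s : elemCentralizer x) (k : ℤ) :
    Commute (s : S) (x ^ k) :=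
  Commute.zpow_right (Subgroup.mem_centralizer_singleton_iff.1 s.2) k

theorem mul_zpow_mul_mul_zpow (a b : elemCentralizer x) (k l : ℤ) :
    (a * x ^ k) * (b * x ^ l) = (a * b : elemCentralizer x) * x ^ (k + l) := by
  rw [mul_assoc, ← mul_assoc (x ^ k), ← (commute_zpow_of_elemCentralizer b k).eq, zpow_add,
    Subgroup.coe_mul]
  simp only [mul_assoc]

theorem mul_zpow_inv (a : elemCentralizer x) (k : ℤ) :
    ((a : S) * x ^ k)⁻¹ = (a⁻¹ : elemCentralizer x) * x ^ (-k) := by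
  rw [(commute_zpow_of_elemCentralizer a k).eq, mul_inv_rev, zpow_neg, Subgroup.coe_inv]

theorem mul_zpow_conj (n a : elemCentralizer x) (k l : ℤ) :
    (n * x ^ k) * (a * x ^ l) * (n * x ^ k)⁻¹ = (n * a * n⁻¹ : elemCentralizer x) * x ^ l := by
  rw [mul_zpow_inv, mul_zpow_mul_mul_zpow, mul_zpow_mul_mul_zpow, add_neg_cancel_comm]

theorem coe_mem_joinElem_of_mem {P : Subgroup (elemCentralizer x)} {a : elemCentralizer x}
    (ha : a ∈ P) : (a : S) ∈ joinElem P :=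
  coe_mem_joinElem ⟨a, ha⟩

theorem mem_joinElem {P : Subgroup (elemCentralizer x)} {s : S} :
    s ∈ joinElem P ↔ ∃ a ∈ P, ∃ k : ℤ, s = a * x ^ k := by
  constructor
  · let K : Subgroup S :=
      { carrier := {s | ∃ a ∈ P, ∃ k : ℤ, s = a * x ^ k}
        one_mem' := ⟨1, one_mem _, 0, by simp⟩
        mul_mem' := by
          rintro _ _ ⟨a, ha, k, rfl⟩ ⟨b, hb, l, rfl⟩
          exact ⟨a * b, mul_mem ha hb, k + l, mul_zpow_mul_mul_zpow a b k l⟩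
        inv_mem' := by
          rintro _ ⟨a, ha, k, rfl⟩
          exact ⟨a⁻¹, inv_mem ha, -k, mul_zpow_inv a k⟩ }
    have hle : joinElem P ≤ K := by
      refine sup_le ?_ (Subgroup.zpowers_le.2 ⟨1, one_mem _, 1, by simp⟩)
      rintro _ ⟨a, ha, rfl⟩
      exact ⟨a, ha, 0, by simp⟩
    exact fun hs => hle hs
  · rintro ⟨a, ha, k, rfl⟩
    exact mul_mem (coe_mem_joinElem_of_mem ha) (zpow_mem (elem_mem_joinElem P) k)

theorem joinElem_mono {P Q : Subgroup (elemCentralizer x)} (h : P ≤ Q) :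
    joinElem P ≤ joinElem Q :=
  sup_le_sup_right (Subgroup.map_mono h) _

theorem joinElem_iSup {ι : Sort*} [Nonempty ι] (P : ι → Subgroup (elemCentralizer x)) :
    joinElem (⨆ i, P i) = ⨆ i, joinElem (P i) := by
  simp only [joinElem, Subgroup.map_iSup, iSup_sup]

theorem joinElem_le (P : Subgroup (elemCentralizer x)) : joinElem P ≤ elemCentralizer x :=
  sup_le (Subgroup.map_subtype_le P) (Subgroup.zpowers_le.2 (mem_elemCentralizer_self x))

theorem joinElem_subgroupOf {P : Subgroup S} (hx : x ∈ P) (hP : P ≤ elemCentralizer x) :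
    joinElem (P.subgroupOf (elemCentralizer x)) = P := by
  rw [joinElem, Subgroup.subgroupOf_map_subtype, inf_eq_left.2 hP, sup_eq_left]
  exact Subgroup.zpowers_le.2 hx

theorem IsMor.map_mem_elemCentralizer {g : S → S} {R : Subgroup S} (hg : F.IsMor g R)
    (hx : x ∈ R) {a : S} (ha : a ∈ R) (hax : a ∈ elemCentralizer x) :
    g a ∈ elemCentralizer (g x) := by
  rw [Subgroup.mem_centralizer_singleton_iff] at hax ⊢
  rw [← hg.map_mul ha hx, ← hg.map_mul hx ha, hax]

theorem IsMor.map_mul_zpow {g : S → S} {P : Subgroup (elemCentralizer x)}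
    (hg : F.IsMor g (joinElem P)) (hx : g x = x) {a : elemCentralizer x} (ha : a ∈ P) (k : ℤ) :
    g (a * x ^ k) = g a * x ^ k := by
  have hxP := elem_mem_joinElem P
  rw [hg.map_mul (coe_mem_joinElem_of_mem ha) (zpow_mem hxP k), hg.map_zpow hxP, hx]

theorem IsMor.eqOn_joinElem {f g : S → S} {P : Subgroup (elemCentralizer x)}
    (hf : F.IsMor f (joinElem P)) (hg : F.IsMor g (joinElem P)) (hfx : f x = x) (hgx : g x = x)
    (h : ∀ a ∈ P, f a = g a) : Set.EqOn f g (joinElem P) := fun s hs => by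
  obtain ⟨a, ha, k, rfl⟩ := mem_joinElem.1 hs
  rw [hf.map_mul_zpow hfx ha, hg.map_mul_zpow hgx ha, h a ha]

theorem isMor_centralizer_iff {f : elemCentralizer x → elemCentralizer x}
    {P : Subgroup (elemCentralizer x)} : (F.centralizer x).IsMor f P ↔
      ∃ g, F.IsMor g (joinElem P) ∧ g x = x ∧ ∀ a ∈ P, g a = f a := by
  constructor
  · rintro ⟨φ, ⟨ψ, hψ, hx, hψφ⟩, hφ⟩
    obtain ⟨g, hg, hgψ⟩ := exists_isMor_of_mem_hom hψ
    refine ⟨g, hg, (hgψ ⟨x, elem_mem_joinElem P⟩).trans hx, fun a ha => ?_⟩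
    rw [← hφ ⟨a, ha⟩, ← hψφ ⟨a, ha⟩]
    exact hgψ ⟨a, coe_mem_joinElem ⟨a, ha⟩⟩
  · rintro ⟨g, hg, hx, hgf⟩
    have hgC : ∀ a ∈ joinElem P, g a ∈ joinElem (⊤ : Subgroup (elemCentralizer x)) := by
      intro a ha
      have hga := hg.map_mem_elemCentralizer (elem_mem_joinElem P) ha (joinElem_le P ha)
      exact coe_mem_joinElem ⟨⟨g a, hx ▸ hga⟩, Subgroup.mem_top _⟩
    refine ⟨homOfMulOn P ⊤ f (fun a ha b hb => Subtype.ext ?_) fun _ _ => Subgroup.mem_top _,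
      ⟨homOfMulOn _ _ g (fun a ha b hb => hg.map_mul ha hb) hgC, hg.mem_hom _ fun a => rfl, hx,
        fun a => hgf a a.2⟩, fun a => rfl⟩
    rw [Subgroup.coe_mul, ← hgf _ (mul_mem ha hb), ← hgf a ha, ← hgf b hb]
    exact hg.map_mul (coe_mem_joinElem_of_mem ha) (coe_mem_joinElem_of_mem hb)

theorem IsIso.exists_isIso_joinElem {f : elemCentralizer x → elemCentralizer x}
    {P Q : Subgroup (elemCentralizer x)} (hf : (F.centralizer x).IsIso f P Q) :
    ∃ g, F.IsIso g (joinElem P) (joinElem Q) ∧ g x = x ∧ ∀ a ∈ P, g a = f a := by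
  obtain ⟨g, hg, hx, hgf⟩ := isMor_centralizer_iff.1 hf.isMor
  refine ⟨g, ⟨hg, Set.ext fun b => ⟨?_, fun hb => ?_⟩⟩, hx, hgf⟩
  · rintro ⟨s, hs, rfl⟩
    obtain ⟨a, ha, k, rfl⟩ := mem_joinElem.1 hs
    exact mem_joinElem.2 ⟨f a, hf.map_mem ha, k, by rw [hg.map_mul_zpow hx ha, hgf a ha]⟩
  · obtain ⟨_, hbQ, k, rfl⟩ := mem_joinElem.1 hb
    obtain ⟨a, ha, rfl⟩ := hf.mem_iff.1 hbQ
    exact ⟨a * x ^ k, mem_joinElem.2 ⟨a, ha, k, rfl⟩, by rw [hg.map_mul_zpow hx ha, hgf a ha]⟩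

theorem IsIso.le_elemCentralizer {g : S → S} {P : Subgroup (elemCentralizer x)} {R : Subgroup S}
    (hg : F.IsIso g (joinElem P) R) : R ≤ elemCentralizer (g x) := fun b hb => by
  obtain ⟨a, ha, rfl⟩ := hg.mem_iff.1 hb
  exact hg.isMor.map_mem_elemCentralizer (elem_mem_joinElem P) ha (joinElem_le P ha)

theorem IsIso.exists_isIso_centralizer {g : S → S} {P : Subgroup (elemCentralizer x)}
    {R : Subgroup S} (hg : F.IsIso g (joinElem P) R) (hx : g x = x) :
    ∃ f Q, (F.centralizer x).IsIso f P Q ∧ joinElem Q = R ∧ ∀ a ∈ P, (f a : S) = g a := by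
  have hcoe : ∀ a ∈ P, (toCentralizer x (g a) : S) = g a := fun a ha => coe_toCentralizer <| by
    simpa only [hx] using hg.isMor.map_mem_elemCentralizer (elem_mem_joinElem P)
      (coe_mem_joinElem_of_mem ha) a.2
  have hf : (F.centralizer x).IsMor (fun a => toCentralizer x (g a)) P :=
    isMor_centralizer_iff.2 ⟨g, hg.isMor, hx, fun a ha => (hcoe a ha).symm⟩
  obtain ⟨Q, hQ⟩ := hf.exists_isIso
  obtain ⟨g', hg', hx', hg'f⟩ := hQ.exists_isIso_joinElem
  have hgg' := hg'.isMor.eqOn_joinElem hg.isMor hx' hx fun a ha => (hg'f a ha).trans (hcoe a ha)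
  refine ⟨_, Q, hQ, SetLike.coe_injective ?_, hcoe⟩
  rw [← hg'.image_eq, ← hg.image_eq, Set.image_congr hgg']

theorem mem_centralizer_joinElem {P : Subgroup (elemCentralizer x)} {s : S} :
    s ∈ Subgroup.centralizer (joinElem P : Set S) ↔
      s ∈ elemCentralizer x ∧ ∀ a ∈ P, (a : S) * s = s * a := by
  rw [Subgroup.mem_centralizer_iff]
  constructor
  · intro h
    exact ⟨Subgroup.mem_centralizer_singleton_iff.2 (h x (elem_mem_joinElem P)).symm,
      fun a ha => h a (coe_mem_joinElem ⟨a, ha⟩)⟩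
  · rintro ⟨hs, h⟩ b hb
    obtain ⟨a, ha, k, rfl⟩ := mem_joinElem.1 hb
    exact Commute.mul_left (h a ha) (commute_zpow_of_elemCentralizer ⟨s, hs⟩ k).symm

theorem toralOrder_centralizer_joinElem [Fact p.Prime] (hS : IsPToral p S)
    (P : Subgroup (elemCentralizer x)) :
    toralOrder p (Subgroup.centralizer (joinElem P : Set S)) =
      toralOrder p (Subgroup.centralizer (P : Set (elemCentralizer x))) := by
  have hC : ∀ s ∈ Subgroup.centralizer (joinElem P : Set S), s ∈ elemCentralizer x :=
    fun s hs => (mem_centralizer_joinElem.1 hs).1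
  apply le_antisymm
  · refine (hS.subgroup (elemCentralizer x)).toralOrder_le_of_injOn
      (fun a ha b hb => toCentralizer_mul (hC a ha) (hC b hb)) (toCentralizer_injOn hC)
      fun s hs => Subgroup.mem_centralizer_iff.2 fun a ha => Subtype.ext ?_
    rw [Subgroup.coe_mul, Subgroup.coe_mul, coe_toCentralizer (hC s hs)]
    exact (mem_centralizer_joinElem.1 hs).2 a ha
  · refine hS.toralOrder_le_of_injOn (f := Subtype.val) (fun _ _ _ _ => rfl)
      Subtype.val_injective.injOn fun s hs => mem_centralizer_joinElem.2 ⟨s.2, fun a ha => ?_⟩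
    exact congrArg Subtype.val (Subgroup.mem_centralizer_iff.1 hs a ha)

end Centralizer

end FusionSystem

/-! ### Locally saturated fusion systems -/

namespace FusionSystem

section LocallySaturated

variable {p : ℕ} {S : Type*} [Group S] {F : FusionSystem S} {f g ρ ρ' : S → S} {x y : S}
  {D N N₁ P P₁ Q : Subgroup S}

/-- Whenever `x` is `F`-conjugate to `y`, some morphism of `F` defined on all of `C_S(x)` sends `x`
to `y`. This is condition (b)(ii) of the theorem for a single `y`. -/
def IsReceptive (F : FusionSystem S) (y : S) : Prop :=
  ∀ x, F.IsConjugateElement x y → ∃ ρ, F.IsMor ρ (elemCentralizer x) ∧ ρ x = y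

/-- Each element of order `p` is `F`-conjugate to a receptive element `y` such that `C_F(y)` is
saturated. This is condition (b) of the theorem with `𝔛` chosen as large as possible. -/
def IsLocallySaturated (p : ℕ) (F : FusionSystem S) : Prop :=
  ∀ x : S, orderOf x = p →
    ∃ y, F.IsConjugateElement x y ∧ F.IsReceptive y ∧ (F.centralizer y).IsSaturated p

theorem centralizer_le_elemCentralizer (hx : x ∈ P) :
    Subgroup.centralizer (P : Set S) ≤ elemCentralizer x :=
  Subgroup.centralizer_le (Set.singleton_subset_iff.2 hx)

theorem normalizer_le_elemCentralizer {x : P} (hx : ∀ α ∈ autBy P, α x = x) :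
    Subgroup.normalizer (P : Set S) ≤ elemCentralizer (x : S) := fun n hn =>
  mem_elemCentralizer_iff_conj_eq.2 (congrArg Subtype.val (hx _ ⟨⟨n, hn⟩, rfl⟩))

theorem IsReceptive.fullyCentralized_joinElem [Fact p.Prime] (hS : IsPToral p S)
    (hy : F.IsReceptive y) {P : Subgroup (elemCentralizer y)}
    (hP : (F.centralizer y).FullyCentralized p P) : F.FullyCentralized p (joinElem P) := by
  refine fullyCentralized_iff.2 fun g R hg => ?_
  have hyP := elem_mem_joinElem P
  have hgy : g y ∈ R := hg.map_mem hyP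
  obtain ⟨k, hk, hkg, -⟩ := hg.exists_symm
  obtain ⟨ρ, hρ, hρy⟩ := hy (g y) (by simpa only [hkg y hyP] using hk.isMor.isConjugateElement hgy)
  have hRC := hg.le_elemCentralizer
  obtain ⟨R', hR'⟩ := (hρ.mono hRC).exists_isIso
  obtain ⟨f, Q, hf, rfl, -⟩ := (hg.trans hR').exists_isIso_centralizer hρy
  calc toralOrder p (Subgroup.centralizer (R : Set S))
      ≤ toralOrder p (Subgroup.centralizer (joinElem Q : Set S)) :=
        hρ.toralOrder_centralizer_le hS hRC (centralizer_le_elemCentralizer hgy) hR'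
    _ = toralOrder p (Subgroup.centralizer (Q : Set (elemCentralizer y))) :=
        toralOrder_centralizer_joinElem hS Q
    _ ≤ toralOrder p (Subgroup.centralizer (P : Set (elemCentralizer y))) :=
        fullyCentralized_iff.1 hP f Q hf
    _ = toralOrder p (Subgroup.centralizer (joinElem P : Set S)) :=
        (toralOrder_centralizer_joinElem hS P).symm

theorem FullyCentralized.of_joinElem [Fact p.Prime] (hS : IsPToral p S)
    {P : Subgroup (elemCentralizer y)} (hP : F.FullyCentralized p (joinElem P)) :
    (F.centralizer y).FullyCentralized p P := by
  refine fullyCentralized_iff.2 fun f Q hf => ?_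
  obtain ⟨g, hg, -, -⟩ := hf.exists_isIso_joinElem
  rw [← toralOrder_centralizer_joinElem hS, ← toralOrder_centralizer_joinElem hS]
  exact fullyCentralized_iff.1 hP g _ hg

theorem comap_autBy_subgroupOf {C : Subgroup S} (hN : Subgroup.normalizer (P : Set S) ≤ C) :
    (autBy P).comap (MulAut.congr
      (Subgroup.subgroupOfEquivOfLe (Subgroup.le_normalizer.trans hN))).toMonoidHom =
        autBy (P.subgroupOf C) := by
  let e := Subgroup.subgroupOfEquivOfLe (Subgroup.le_normalizer.trans hN)
  ext α
  constructor
  · rintro ⟨n, hn⟩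
    exact mem_autBy_iff.2 ⟨⟨n, hN n.2⟩, fun a =>
      Subtype.ext (congrArg Subtype.val (DFunLike.congr_fun hn (e a))).symm⟩
  · intro hα
    obtain ⟨n, hn⟩ := mem_autBy_iff.1 hα
    exact mem_autBy_iff.2 ⟨n, fun a => congrArg Subtype.val (hn (e.symm a))⟩

theorem map_aut_centralizer (hyP : y ∈ P) (hPC : P ≤ elemCentralizer y) :
    ((F.centralizer y).aut (P.subgroupOf (elemCentralizer y))).map
      (MulAut.congr (Subgroup.subgroupOfEquivOfLe hPC)).toMonoidHom =
        MulAction.stabilizer (MulAut P) (⟨y, hyP⟩ : P) ⊓ F.aut P := by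
  let e := Subgroup.subgroupOfEquivOfLe hPC
  have hjoin := joinElem_subgroupOf hyP hPC
  ext β
  constructor
  · rintro ⟨α, hα, rfl⟩
    obtain ⟨f, hf, hfα⟩ := mem_aut_iff.1 hα
    obtain ⟨g, hg, hgy, hgf⟩ := isMor_centralizer_iff.1 hf
    rw [hjoin] at hg
    have hαg : ∀ a : P, ((α (e.symm a) : elemCentralizer y) : S) = g a := fun a => by
      rw [hfα, ← hgf _ (e.symm a).2]
      rfl
    exact ⟨MulAction.mem_stabilizer_iff.2 (Subtype.ext ((hαg ⟨y, hyP⟩).trans hgy)),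
      mem_aut_iff.2 ⟨g, hg, hαg⟩⟩
  · rintro ⟨hβy, hβ⟩
    obtain ⟨g, hg, hβg⟩ := mem_aut_iff.1 hβ
    have hgy : g y = y := (hβg ⟨y, hyP⟩).symm.trans (congrArg Subtype.val hβy)
    have hcoe : ∀ a ∈ P, (toCentralizer y (g a) : S) = g a := fun a ha =>
      coe_toCentralizer (hβg ⟨a, ha⟩ ▸ hPC (β _).2)
    have hmor : (F.centralizer y).IsMor (fun a => toCentralizer y (g a))
        (P.subgroupOf (elemCentralizer y)) :=
      isMor_centralizer_iff.2 ⟨g, hjoin.symm ▸ hg, hgy, fun a ha => (hcoe a ha).symm⟩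
    refine ⟨MulAut.congr e.symm β, mem_aut_iff.2 ⟨_, hmor, fun a => Subtype.ext ?_⟩,
      (MulAut.congr e).apply_symm_apply β⟩
    exact (hβg (e a)).trans (hcoe a a.2).symm

theorem autBy_le_stabilizer (hyP : y ∈ P)
    (hN : Subgroup.normalizer (P : Set S) ≤ elemCentralizer y) :
    autBy P ≤ MulAction.stabilizer (MulAut P) (⟨y, hyP⟩ : P) := by
  rintro _ ⟨n, rfl⟩
  exact MulAction.mem_stabilizer_iff.2
    (Subtype.ext (mem_elemCentralizer_iff_conj_eq.1 (hN n.2)))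

theorem HasSylowAut.of_centralizer [Fact p.Prime] (hyP : y ∈ P)
    (hN : Subgroup.normalizer (P : Set S) ≤ elemCentralizer y)
    (hst : ¬ p ∣ (MulAction.stabilizer (MulAut P) (⟨y, hyP⟩ : P)).relIndex (F.aut P))
    (h : (F.centralizer y).HasSylowAut p (P.subgroupOf (elemCentralizer y))) :
    F.HasSylowAut p P := by
  have hPC : P ≤ elemCentralizer y := Subgroup.le_normalizer.trans hN
  have hA : autBy P ≤ MulAction.stabilizer (MulAut P) (⟨y, hyP⟩ : P) ⊓ F.aut P :=
    le_inf (autBy_le_stabilizer hyP hN) autBy_le_aut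
  rw [HasSylowAut, ← comap_innerAut_congr (Subgroup.subgroupOfEquivOfLe hPC),
    ← comap_autBy_subgroupOf hN, Subgroup.relIndex_comap, Subgroup.relIndex_comap,
    map_aut_centralizer hyP hPC] at h
  constructor
  · rw [← Subgroup.relIndex_mul_relIndex _ _ _ (innerAut_le_autBy.trans hA) inf_le_right,
      Subgroup.inf_relIndex_right]
    exact mul_ne_zero h.1 fun h0 => hst (h0 ▸ dvd_zero p)
  · rw [← Subgroup.relIndex_mul_relIndex _ _ _ hA inf_le_right, Subgroup.inf_relIndex_right]
    exact fun hd => ((Fact.out : p.Prime).dvd_mul.1 hd).elim h.2 hst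

theorem hasSylowAut_bot [Fact p.Prime] : F.HasSylowAut p ⊥ := by
  have hindex : ∀ A : Subgroup (MulAut (⊥ : Subgroup S)), A.relIndex (F.aut ⊥) = 1 := fun A =>
    Subgroup.relIndex_eq_one.2 fun α _ => Subsingleton.elim 1 α ▸ one_mem A
  rw [HasSylowAut, hindex, hindex]
  exact ⟨one_ne_zero, (Fact.out : p.Prime).not_dvd_one⟩

theorem fullyCentralized_bot : F.FullyCentralized p ⊥ := by
  refine fullyCentralized_iff.2 fun f Q hf => ?_
  have hQ : Q = ⊥ := SetLike.coe_injective (by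
    rw [← hf.image_eq, Subgroup.coe_bot, Set.image_singleton, hf.isMor.map_one])
  rw [hQ]

/-! ### Axiom (I) for locally saturated fusion systems -/

theorem toralOrder_normalizer_le_joinElem [Fact p.Prime] (hS : IsPToral p S)
    (R : Subgroup (elemCentralizer y)) :
    toralOrder p (Subgroup.normalizer (R : Set (elemCentralizer y))) ≤
      toralOrder p (Subgroup.normalizer (joinElem R : Set S)) := by
  have hle : (Subgroup.normalizer (R : Set (elemCentralizer y))).map
      (elemCentralizer y).subtype ≤ Subgroup.normalizer (joinElem R : Set S) := by
    refine le_normalizer_of_forall_conj_mem ?_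
    rintro _ ⟨n, hn, rfl⟩ s hs
    obtain ⟨a, ha, k, rfl⟩ := mem_joinElem.1 hs
    refine mem_joinElem.2 ⟨n * a * n⁻¹, (Subgroup.mem_normalizer_iff.1 hn a).1 ha, k, ?_⟩
    simpa only [zpow_zero, mul_one, Subgroup.subtype_apply] using mul_zpow_conj n a 0 k
  exact hS.toralOrder_le_of_injOn (f := Subtype.val) (fun _ _ _ _ => rfl)
    Subtype.val_injective.injOn fun n hn => hle ⟨n, hn, rfl⟩

theorem toralOrder_normalizer_subgroupOf [Fact p.Prime] (hS : IsPToral p S) {C : Subgroup S}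
    (hN : Subgroup.normalizer (P : Set S) ≤ C) :
    toralOrder p (Subgroup.normalizer (P : Set S)) ≤
      toralOrder p (Subgroup.normalizer (P.subgroupOf C : Set C)) := by
  rw [← Subgroup.subgroupOf_normalizer_eq (Subgroup.le_normalizer.trans hN)]
  exact ((hS.subgroup C).subgroup _).toralOrder_le
    (f := (Subgroup.subgroupOfEquivOfLe hN).symm.toMonoidHom) (MulEquiv.injective _)

theorem FullyNormalized.subgroupOf_elemCentralizer [Fact p.Prime] (hS : IsPToral p S)
    (hP : F.FullyNormalized p P) (hyP : y ∈ P)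
    (hN : Subgroup.normalizer (P : Set S) ≤ elemCentralizer y) :
    (F.centralizer y).FullyNormalized p (P.subgroupOf (elemCentralizer y)) := by
  refine fullyNormalized_iff.2 fun f R hf => ?_
  obtain ⟨g, hg, -, -⟩ := hf.exists_isIso_joinElem
  rw [joinElem_subgroupOf hyP (Subgroup.le_normalizer.trans hN)] at hg
  exact ((toralOrder_normalizer_le_joinElem hS R).trans (fullyNormalized_iff.1 hP g _ hg)).trans
    (toralOrder_normalizer_subgroupOf hS hN)

theorem IsReceptive.fullyCentralized_and_hasSylowAut [Fact p.Prime] (hS : IsPToral p S)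
    (hy : F.IsReceptive y) (hF : (F.centralizer y).SylowAxiom p) (hP : F.FullyNormalized p P)
    (hyP : y ∈ P) (hN : Subgroup.normalizer (P : Set S) ≤ elemCentralizer y)
    (hst : ¬ p ∣ (MulAction.stabilizer (MulAut P) (⟨y, hyP⟩ : P)).relIndex (F.aut P)) :
    F.FullyCentralized p P ∧ F.HasSylowAut p P := by
  obtain ⟨hcent, hsylow⟩ := (sylowAxiom_iff (hS.subgroup _).isPGroup).1 hF _
    (hP.subgroupOf_elemCentralizer hS hyP hN)
  refine ⟨?_, hsylow.of_centralizer hyP hN hst⟩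
  simpa only [joinElem_subgroupOf hyP (Subgroup.le_normalizer.trans hN)] using
    hy.fullyCentralized_joinElem hS hcent

theorem IsLocallySaturated.sylowAxiom [Fact p.Prime] (hS : IsPToral p S)
    (hF : F.IsLocallySaturated p) : F.SylowAxiom p := by
  refine (sylowAxiom_iff hS.isPGroup).2 fun P hP => ?_
  rcases eq_or_ne P ⊥ with rfl | hPbot
  · exact ⟨fullyCentralized_bot, hasSylowAut_bot⟩
  have : Nontrivial P := (Subgroup.nontrivial_iff_ne_bot P).2 hPbot
  obtain ⟨x, -, hxp, hxA, hst⟩ := (hS.subgroup P).exists_fixed_orderOf_eq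
    (isPGroup_autBy hS.isPGroup P) (autBy_le_aut (F := F))
  have hNx := normalizer_le_elemCentralizer hxA
  obtain ⟨y, hxy, hy, hsat⟩ := hF x (by rw [Subgroup.orderOf_coe, hxp])
  obtain ⟨ρ, hρ, rfl⟩ := hy x hxy
  obtain ⟨Q, hQ⟩ := (hρ.mono (Subgroup.le_normalizer.trans hNx)).exists_isIso
  have hN := hP.isIso_normalizer hS hρ hNx hQ
  have hQN : F.FullyNormalized p Q := hP.of_isIso hQ (hN.toralOrder_eq hS).le
  have hNy : Subgroup.normalizer (Q : Set S) ≤ elemCentralizer (ρ x) := fun m hm => by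
    obtain ⟨n, hn, rfl⟩ := hN.mem_iff.1 hm
    exact hρ.map_mem_elemCentralizer (mem_elemCentralizer_self _) (hNx hn) (hNx hn)
  obtain ⟨e, -, -, he⟩ := hQ.exists_mulEquiv
  have hex : e x = ⟨ρ x, hQ.map_mem x.2⟩ := Subtype.ext (he x)
  obtain ⟨hcent, hsylow⟩ := hy.fullyCentralized_and_hasSylowAut hS hsat.sylowAxiom hQN
    (hQ.map_mem x.2) hNy (by
      rwa [relIndex_aut_congr e hQ he, ← hex, comap_stabilizer_congr])
  exact ⟨hcent.of_isIso_normalizer hS hN hQ, hsylow.of_isIso_normalizer hN hQ⟩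

/-! ### Axiom (II) for locally saturated fusion systems -/

theorem FullyCentralized.isIso_centralizer [Fact p.Prime] (hS : IsPToral p S)
    (hP : F.FullyCentralized p P) (hρ : F.IsMor ρ D) (hPD : P ≤ D)
    (hCD : Subgroup.centralizer (P : Set S) ≤ D) (hPQ : F.IsIso ρ P Q) :
    F.IsIso ρ (Subgroup.centralizer (P : Set S)) (Subgroup.centralizer (Q : Set S)) := by
  have hmem : ∀ c ∈ Subgroup.centralizer (P : Set S), ρ c ∈ Subgroup.centralizer (Q : Set S) :=
    fun c hc => hρ.map_mem_centralizer hPD hPQ (hCD hc) hc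
  have hsurj := hS.surjOn_of_toralOrder_le (fun a ha b hb => hρ.map_mul (hCD ha) (hCD hb))
    (hρ.injOn.mono hCD) hmem (fullyCentralized_iff.1 hP _ _ hPQ)
  exact ⟨hρ.mono hCD, hsurj.image_eq_of_mapsTo hmem⟩

theorem _root_.LeExtensionDomain.le_elemCentralizer (hN : LeExtensionDomain f P N)
    (hf : F.IsIso f P Q) (hx : x ∈ P)
    (hQ : Subgroup.normalizer (Q : Set S) ≤ elemCentralizer (f x)) :
    N ≤ elemCentralizer x := fun n hn => by
  obtain ⟨hnP, h, hh⟩ := hN n hn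
  have hhQ := hf.mem_normalizer_of_map_conj (hN.le_normalizer hn) hh
  refine mem_elemCentralizer_iff_conj_eq.2 (hf.isMor.injOn (hnP x hx) hx ?_)
  rw [hh x hx, mem_elemCentralizer_iff_conj_eq.1 (hQ hhQ)]

theorem _root_.LeExtensionDomain.transport (hN : LeExtensionDomain f P N) (hf : F.IsIso f P Q)
    (hPN : P ≤ N) (hρ : F.IsIso ρ N N₁) (hP₁ : F.IsIso ρ P P₁) (hρ' : F.IsMor ρ' D)
    (hQD : Subgroup.normalizer (Q : Set S) ≤ D) (hg : ∀ a ∈ P, g (ρ a) = ρ' (f a)) :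
    LeExtensionDomain g P₁ N₁ := by
  intro m hm
  obtain ⟨n, hn, rfl⟩ := hρ.mem_iff.1 hm
  obtain ⟨hnP, h, hh⟩ := hN n hn
  have hhQ := hf.mem_normalizer_of_map_conj (hN.le_normalizer hn) hh
  have hconj : ∀ a ∈ P, ρ n * ρ a * (ρ n)⁻¹ = ρ (n * a * n⁻¹) := fun a ha =>
    (hρ.isMor.map_conj hn (hPN ha)).symm
  refine ⟨fun b hb => ?_, ρ' h, fun b hb => ?_⟩ <;> obtain ⟨a, ha, rfl⟩ := hP₁.mem_iff.1 hb
  · rw [hconj a ha]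
    exact hP₁.map_mem (hnP a ha)
  · rw [hconj a ha, hg _ (hnP a ha), hg a ha, hh a ha,
      hρ'.map_conj (hQD hhQ) (hQD (Subgroup.le_normalizer (hf.map_mem ha)))]

theorem ExtensionAxiom.exists_extension_of_centralizer [Fact p.Prime] (hS : IsPToral p S)
    (hF : (F.centralizer y).ExtensionAxiom p) (hg : F.IsIso g P Q) (hyP : y ∈ P) (hgy : g y = y)
    (hQ : F.FullyCentralized p Q) (hPN : P ≤ N) (hNC : N ≤ elemCentralizer y)
    (hN : LeExtensionDomain g P N) : ∃ k, F.IsMor k N ∧ ∀ a ∈ P, k a = g a := by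
  have hPC := hPN.trans hNC
  rw [← joinElem_subgroupOf hyP hPC] at hg
  obtain ⟨f, Q', hf, rfl, hfg⟩ := hg.exists_isIso_centralizer hgy
  obtain ⟨k, hk, hkf⟩ := extensionAxiom_iff.1 hF f _ Q' (N.subgroupOf (elemCentralizer y)) hf
    (.of_joinElem hS hQ) (Subgroup.comap_mono hPN) fun n hn => by
      obtain ⟨hnP, h, hh⟩ := hN n hn
      have hhC : h ∈ elemCentralizer y := mem_elemCentralizer_iff_conj_eq.2 <| by
        simpa only [mem_elemCentralizer_iff_conj_eq.1 n.2, hgy] using (hh y hyP).symm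
      refine ⟨fun a ha => hnP a ha, ⟨h, hhC⟩, fun a ha => Subtype.ext ?_⟩
      change (f _ : S) = h * f a * h⁻¹
      rw [hfg _ (hnP a ha), hfg a ha]
      exact hh a ha
  obtain ⟨k', hk', -, hk'k⟩ := isMor_centralizer_iff.1 hk
  rw [joinElem_subgroupOf (hPN hyP) hNC] at hk'
  refine ⟨k', hk', fun a ha => ?_⟩
  rw [hk'k ⟨a, hPC ha⟩ (hPN ha), hkf ⟨a, hPC ha⟩ ha, hfg ⟨a, hPC ha⟩ ha]

theorem exists_extension_comp_of_centralizer [Fact p.Prime] (hS : IsPToral p S)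
    (hF : (F.centralizer y).ExtensionAxiom p) (hf : F.IsIso f P Q) (hQ : F.FullyCentralized p Q)
    (hPN : P ≤ N) (hN : LeExtensionDomain f P N) (hx : x ∈ P)
    (hNQ : Subgroup.normalizer (Q : Set S) ≤ elemCentralizer (f x))
    (hρ : F.IsMor ρ (elemCentralizer x)) (hρx : ρ x = y)
    (hρ' : F.IsMor ρ' (elemCentralizer (f x))) (hρfx : ρ' (f x) = y) :
    ∃ g, F.IsMor g N ∧ ∀ a ∈ P, g a = ρ' (f a) := by
  have hNC := hN.le_elemCentralizer hf hx hNQ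
  have hQC : Q ≤ elemCentralizer (f x) := Subgroup.le_normalizer.trans hNQ
  have hCQ := centralizer_le_elemCentralizer (hf.map_mem hx)
  obtain ⟨P₁, hP₁⟩ := (hρ.mono (hPN.trans hNC)).exists_isIso
  obtain ⟨N₁, hN₁⟩ := (hρ.mono hNC).exists_isIso
  obtain ⟨Q₁, hQ₁⟩ := (hρ'.mono hQC).exists_isIso
  obtain ⟨k, hk, hkρ, -⟩ := hP₁.exists_symm
  have hψρ : ∀ a ∈ P, ρ' (f (k (ρ a))) = ρ' (f a) := fun a ha => by rw [hkρ a ha]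
  have hN₁C : N₁ ≤ elemCentralizer y := fun b hb => by
    obtain ⟨a, ha, rfl⟩ := hN₁.mem_iff.1 hb
    exact hρx ▸ hρ.map_mem_elemCentralizer (mem_elemCentralizer_self _) (hNC ha) (hNC ha)
  have hP₁N₁ : P₁ ≤ N₁ := fun b hb => by
    obtain ⟨a, ha, rfl⟩ := hP₁.mem_iff.1 hb
    exact hN₁.map_mem (hPN ha)
  have hQ₁C : F.FullyCentralized p Q₁ :=
    hQ.of_isIso hQ₁ (hρ'.toralOrder_centralizer_le hS hQC hCQ hQ₁)
  obtain ⟨g, hg, hgψ⟩ := hF.exists_extension_of_centralizer hS ((hk.trans hf).trans hQ₁)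
    (hρx ▸ hP₁.map_mem hx) (by rw [← hρx, hψρ x hx, hρfx, hρx]) hQ₁C hP₁N₁ hN₁C
    (hN.transport hf hPN hN₁ hP₁ hρ' hNQ hψρ)
  exact ⟨_, (hρ.mono hNC).comp hg fun a ha => hN₁.map_mem ha,
    fun a ha => (hgψ _ (hP₁.map_mem ha)).trans (hψρ a ha)⟩

theorem FullyCentralized.exists_extension_of_comp [Fact p.Prime] (hS : IsPToral p S)
    (hQ : F.FullyCentralized p Q) (hf : F.IsIso f P Q) (hρ : F.IsMor ρ D)
    (hQD : Subgroup.normalizer (Q : Set S) ≤ D) (hPN : P ≤ N) (hN : LeExtensionDomain f P N)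
    (hg : F.IsMor g N) (hgf : ∀ a ∈ P, g a = ρ (f a)) :
    ∃ k, F.IsMor k N ∧ ∀ a ∈ P, k a = f a := by
  have hQ' : Q ≤ D := Subgroup.le_normalizer.trans hQD
  have hCD := (Subgroup.centralizer_le_normalizer (Q : Set S)).trans hQD
  obtain ⟨Q₁, hQ₁⟩ := (hρ.mono hQ').exists_isIso
  obtain ⟨D₁, hD₁⟩ := hρ.exists_isIso
  have hC := hQ.isIso_centralizer hS hρ hQ' hCD hQ₁
  have hgD₁ : ∀ n ∈ N, g n ∈ D₁ := fun n hn => by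
    obtain ⟨hnP, h, hh⟩ := hN n hn
    have hhD : h ∈ D := hQD (hf.mem_normalizer_of_map_conj (hN.le_normalizer hn) hh)
    -- `g n` and `ρ h` induce the same automorphism of `ρ(Q)`, and `C_S(ρ(Q)) = ρ(C_S(Q))`.
    have hcent : (ρ h)⁻¹ * g n ∈ Subgroup.centralizer (Q₁ : Set S) := by
      refine Subgroup.mem_centralizer_iff.2 fun b hb => ?_
      obtain ⟨q, hq, rfl⟩ := hQ₁.mem_iff.1 hb
      obtain ⟨a, ha, rfl⟩ := hf.mem_iff.1 hq
      have hconj : g n * ρ (f a) * (g n)⁻¹ = ρ h * ρ (f a) * (ρ h)⁻¹ := by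
        rw [← hgf a ha, ← hg.map_conj hn (hPN ha), hgf _ (hnP a ha), hh a ha,
          hρ.map_conj hhD (hQ' hq), hgf a ha]
      rw [mul_inv_eq_iff_eq_mul] at hconj
      rw [mul_assoc, hconj]
      group
    obtain ⟨d, hd, hρd⟩ := hC.mem_iff.1 hcent
    exact hD₁.mem_iff.2 ⟨h * d, mul_mem hhD (hCD hd), by
      rw [hρ.map_mul hhD (hCD hd), hρd, mul_inv_cancel_left]⟩
  obtain ⟨k, hk, hkρ, -⟩ := hD₁.exists_symm
  refine ⟨_, hg.comp hk.isMor hgD₁, fun a ha => ?_⟩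
  rw [hgf a ha, hkρ _ (hQ' (hf.map_mem ha))]

theorem IsLocallySaturated.extensionAxiom [Fact p.Prime] (hS : IsPToral p S)
    (hF : F.IsLocallySaturated p) : F.ExtensionAxiom p := by
  refine extensionAxiom_iff.2 fun f P Q N hf hQ hPN hN => ?_
  rcases eq_or_ne P ⊥ with rfl | hPbot
  · refine ⟨id, F.isMor_id N, fun a ha => ?_⟩
    rw [Subgroup.mem_bot.1 ha, hf.isMor.map_one, id]
  have : Nontrivial P := (Subgroup.nontrivial_iff_ne_bot P).2 hPbot
  obtain ⟨e, -, -, -⟩ := hf.exists_mulEquiv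
  have : Nontrivial Q := e.symm.toEquiv.nontrivial
  obtain ⟨⟨x', hx'⟩, -, hxp, hxA, -⟩ := (hS.subgroup Q).exists_fixed_orderOf_eq
    (isPGroup_autBy hS.isPGroup Q) (autBy_le_aut (F := F))
  have hNQ := normalizer_le_elemCentralizer hxA
  obtain ⟨x, hx, rfl⟩ := hf.mem_iff.1 hx'
  obtain ⟨y, hxy, hy, hsat⟩ := hF (f x) ((Subgroup.orderOf_mk _ _).symm.trans hxp)
  obtain ⟨ρ', hρ', hρfx⟩ := hy (f x) hxy
  obtain ⟨ρ, hρ, hρx⟩ := hy x ((hf.isMor.isConjugateElement hx).trans hxy)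
  obtain ⟨g, hg, hgf⟩ := exists_extension_comp_of_centralizer hS hsat.extensionAxiom hf hQ hPN hN
    hx hNQ hρ hρx hρ' hρfx
  exact hQ.exists_extension_of_comp hS hf hρ' hNQ hPN hN hg hgf

end LocallySaturated

end FusionSystem

/-! ### Saturation of centralizer fusion systems -/

theorem exists_eqOn_of_eqOn_inter {ι α β : Type*} [Nonempty β] {D : ι → Set α} {g : ι → α → β}
    (h : ∀ i j, Set.EqOn (g i) (g j) (D i ∩ D j)) : ∃ f, ∀ i, Set.EqOn f (g i) (D i) := by
  have hval : ∀ a, ∃ b, ∀ i, a ∈ D i → b = g i a := fun a => by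
    by_cases ha : ∃ i, a ∈ D i
    · obtain ⟨i, hi⟩ := ha
      exact ⟨g i a, fun j hj => h i j ⟨hi, hj⟩⟩
    · exact ⟨Classical.arbitrary β, fun i hi => (ha ⟨i, hi⟩).elim⟩
  choose f hf using hval
  exact ⟨f, fun i a hi => hf a i hi⟩

namespace FusionSystem

section Saturated

variable {p : ℕ} {S : Type*} [Group S] {F : FusionSystem S} {x : S}

theorem IsMor.isIso_zpowers {f : S → S} (hf : F.IsMor f (Subgroup.zpowers x)) :
    F.IsIso f (Subgroup.zpowers x) (Subgroup.zpowers (f x)) := by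
  refine ⟨hf, Set.ext fun b => ⟨?_, ?_⟩⟩
  · rintro ⟨_, ⟨k, rfl⟩, rfl⟩
    exact ⟨k, (hf.map_zpow (Subgroup.mem_zpowers x) k).symm⟩
  · rintro ⟨k, rfl⟩
    exact ⟨x ^ k, ⟨k, rfl⟩, hf.map_zpow (Subgroup.mem_zpowers x) k⟩

theorem ExtensionAxiom.isReceptive (hF : F.ExtensionAxiom p)
    (hx : F.FullyCentralized p (Subgroup.zpowers x)) : F.IsReceptive x := by
  intro y hyx
  obtain ⟨f, hf, rfl⟩ := isConjugateElement_iff.1 hyx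
  have hconj : ∀ n ∈ elemCentralizer y, ∀ a ∈ Subgroup.zpowers y, n * a * n⁻¹ = a := by
    rintro n hn _ ⟨k, rfl⟩
    exact mul_inv_eq_iff_eq_mul.2 (commute_zpow_of_elemCentralizer ⟨n, hn⟩ k).eq
  obtain ⟨ρ, hρ, hρf⟩ := extensionAxiom_iff.1 hF f _ _ (elemCentralizer y) hf.isIso_zpowers hx
    (Subgroup.zpowers_le.2 (mem_elemCentralizer_self y)) fun n hn =>
      ⟨fun a ha => (hconj n hn a ha).symm ▸ ha, 1, fun a ha => by
        rw [hconj n hn a ha, one_mul, inv_one, mul_one]⟩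
  exact ⟨ρ, hρ, hρf y (Subgroup.mem_zpowers y)⟩

theorem _root_.LeExtensionDomain.joinElem {f : elemCentralizer x → elemCentralizer x} {g : S → S}
    {P N : Subgroup (elemCentralizer x)} (hN : LeExtensionDomain f P N)
    (hg : F.IsMor g (joinElem P)) (hgx : g x = x) (hgf : ∀ a ∈ P, g a = f a) :
    LeExtensionDomain g (joinElem P) (joinElem N) := by
  intro s hs
  obtain ⟨n, hn, k, rfl⟩ := mem_joinElem.1 hs
  obtain ⟨hnP, h, hh⟩ := hN n hn
  refine ⟨fun b hb => ?_, h, fun b hb => ?_⟩ <;> obtain ⟨a, ha, l, rfl⟩ := mem_joinElem.1 hb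
  · rw [mul_zpow_conj]
    exact mem_joinElem.2 ⟨_, hnP a ha, l, rfl⟩
  · rw [mul_zpow_conj, hg.map_mul_zpow hgx (hnP a ha), hg.map_mul_zpow hgx ha, hgf _ (hnP a ha),
      hgf a ha, hh a ha, ← mul_zpow_conj h (f a) 0 l, zpow_zero, mul_one]

theorem ExtensionAxiom.centralizer [Fact p.Prime] (hS : IsPToral p S) (hF : F.ExtensionAxiom p)
    (hx : F.IsReceptive x) : (F.centralizer x).ExtensionAxiom p := by
  refine extensionAxiom_iff.2 fun f P Q N hf hQ hPN hN => ?_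
  obtain ⟨g, hg, hgx, hgf⟩ := hf.exists_isIso_joinElem
  obtain ⟨k, hk, hkg⟩ := extensionAxiom_iff.1 hF g _ _ (joinElem N) hg
    (hx.fullyCentralized_joinElem hS hQ) (joinElem_mono hPN) (hN.joinElem hg.isMor hgx hgf)
  have hkx : k x = x := by rw [hkg x (elem_mem_joinElem P), hgx]
  have hcoe : ∀ n ∈ N, (toCentralizer x (k n) : S) = k n := fun n hn => coe_toCentralizer <| by
    simpa only [hkx] using
      hk.map_mem_elemCentralizer (elem_mem_joinElem N) (coe_mem_joinElem_of_mem hn) n.2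
  refine ⟨fun n => toCentralizer x (k n), isMor_centralizer_iff.2 ⟨k, hk, hkx, fun n hn =>
    (hcoe n hn).symm⟩, fun a ha => Subtype.ext ?_⟩
  rw [hcoe a (hPN ha), hkg a (coe_mem_joinElem_of_mem ha), hgf a ha]

theorem ContinuityAxiom.centralizer (hF : F.ContinuityAxiom) (x : S) :
    (F.centralizer x).ContinuityAxiom := by
  refine continuityAxiom_iff.2 fun P hP f hf => ?_
  choose g hg hgx hgf using fun n => isMor_centralizer_iff.1 (hf n)
  have hle : ∀ m n, m ≤ n → Set.EqOn (g m) (g n) (joinElem (P m)) := fun m n hmn =>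
    (hg m).eqOn_joinElem ((hg n).mono (joinElem_mono (hP hmn))) (hgx m) (hgx n) fun a ha =>
      (hgf m a ha).trans (hgf n a (hP hmn ha)).symm
  obtain ⟨G, hG⟩ := exists_eqOn_of_eqOn_inter (D := fun n => (joinElem (P n) : Set S)) (g := g)
    fun m n s hs => (le_total m n).elim (fun h => hle m n h hs.1) fun h => (hle n m h hs.2).symm
  refine isMor_centralizer_iff.2 ⟨G, ?_, ?_, fun a ha => ?_⟩
  · rw [joinElem_iSup]
    exact continuityAxiom_iff.1 hF _ (fun m n hmn => joinElem_mono (hP hmn)) G fun n =>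
      (hg n).congr (hG n)
  · rw [hG 0 (elem_mem_joinElem _), hgx]
  · obtain ⟨n, hn⟩ := (Subgroup.mem_iSup_of_directed hP.directed_le).1 ha
    rw [hG n (coe_mem_joinElem_of_mem hn), hgf n a hn]

/-- The pairs `(α, β)` with `α ∈ Aut_F(P⟨x⟩)` fixing `x` and `β ∈ Aut(P)` its restriction to `P`.
This group compares `Aut_F(P⟨x⟩)` with `Aut_{C_F(x)}(P)`, the latter being its image under the
second projection. -/
def restrictingAut (F : FusionSystem S) (P : Subgroup (elemCentralizer x)) :
    Subgroup (MulAut (joinElem P) × MulAut P) where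
  carrier := {τ | τ.1 ∈ F.aut (joinElem P) ∧
    τ.1 ⟨x, elem_mem_joinElem P⟩ = ⟨x, elem_mem_joinElem P⟩ ∧
      ∀ a : P, τ.1 ⟨a, coe_mem_joinElem a⟩ = ⟨τ.2 a, coe_mem_joinElem (τ.2 a)⟩}
  one_mem' := ⟨one_mem _, rfl, fun _ => rfl⟩
  mul_mem' := by
    rintro σ τ ⟨hσ, hσx, hσP⟩ ⟨hτ, hτx, hτP⟩
    exact ⟨mul_mem hσ hτ, (congrArg σ.1 hτx).trans hσx,
      fun a => (congrArg σ.1 (hτP a)).trans (hσP (τ.2 a))⟩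
  inv_mem' := by
    rintro τ ⟨hτ, hτx, hτP⟩
    refine ⟨inv_mem hτ, (MulEquiv.symm_apply_eq τ.1).2 hτx.symm,
      fun a => (MulEquiv.symm_apply_eq τ.1).2 ?_⟩
    rw [hτP, Subtype.mk.injEq]
    exact congrArg (fun b : P => ((b : elemCentralizer x) : S))
      (MulEquiv.apply_symm_apply τ.2 a).symm

/-- Restriction of pairs to the automorphism of `P⟨x⟩`. -/
abbrev restrictingAut.fst (F : FusionSystem S) (P : Subgroup (elemCentralizer x)) :
    F.restrictingAut P →* MulAut (joinElem P) :=
  (MonoidHom.fst _ _).comp (F.restrictingAut P).subtype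

/-- Restriction of pairs to the automorphism of `P`. -/
abbrev restrictingAut.snd (F : FusionSystem S) (P : Subgroup (elemCentralizer x)) :
    F.restrictingAut P →* MulAut P :=
  (MonoidHom.snd _ _).comp (F.restrictingAut P).subtype

variable {P : Subgroup (elemCentralizer x)}

theorem range_fst_restrictingAut_le : (restrictingAut.fst F P).range ≤ F.aut (joinElem P) := by
  rintro _ ⟨τ, rfl⟩
  exact τ.2.1

theorem range_snd_restrictingAut : (restrictingAut.snd F P).range = (F.centralizer x).aut P := by
  ext β
  constructor
  · rintro ⟨⟨⟨α, β⟩, hα, hαx, hαβ⟩, rfl⟩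
    obtain ⟨g, hg, hαg⟩ := mem_aut_iff.1 hα
    have hgβ : ∀ a : P, g a = (β a : elemCentralizer x) := fun a =>
      (hαg _).symm.trans (congrArg Subtype.val (hαβ a))
    have hβ : ∀ a : P, (β a : elemCentralizer x) = toCentralizer x (g a) := fun a => by
      rw [hgβ, toCentralizer_coe]
    exact mem_aut_iff.2 ⟨fun a => toCentralizer x (g a), isMor_centralizer_iff.2 ⟨g, hg,
      (hαg _).symm.trans (congrArg Subtype.val hαx), fun a ha => by
        rw [← hβ ⟨a, ha⟩, hgβ ⟨a, ha⟩]⟩, hβ⟩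
  · intro hβ
    obtain ⟨f, hf, hβf⟩ := exists_isIso_of_mem_aut hβ
    obtain ⟨g, hg, hgx, hgf⟩ := hf.exists_isIso_joinElem
    obtain ⟨α, -, -, hα⟩ := hg.exists_mulEquiv
    refine ⟨⟨(α, β), mem_aut_iff.2 ⟨g, hg.isMor, hα⟩, Subtype.ext ((hα _).trans hgx),
      fun a => Subtype.ext ((hα _).trans ?_)⟩, rfl⟩
    rw [hgf a a.2, ← hβf]

theorem relIndex_aut_centralizer (A : Subgroup (MulAut P)) :
    A.relIndex ((F.centralizer x).aut P) = (A.comap (restrictingAut.snd F P)).index := by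
  rw [Subgroup.index_comap, range_snd_restrictingAut]

theorem comap_innerAut_joinElem_le : (innerAut (joinElem P)).comap (restrictingAut.fst F P) ≤
    (innerAut P).comap (restrictingAut.snd F P) := by
  rintro ⟨⟨α, β⟩, _, _, hαβ⟩ hα
  obtain ⟨s, hs, hsα⟩ := mem_innerAut_iff.1 (show α ∈ innerAut _ from hα)
  obtain ⟨c, hc, k, rfl⟩ := mem_joinElem.1 hs
  refine mem_innerAut_iff.2 ⟨c, hc, fun a => Subtype.ext ?_⟩
  calc ((β a : elemCentralizer x) : S) = α ⟨a, coe_mem_joinElem a⟩ :=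
        (congrArg Subtype.val (hαβ a)).symm
    _ = (c * x ^ k) * (a * x ^ (0 : ℤ)) * (c * x ^ k)⁻¹ := by
        rw [zpow_zero, mul_one]; exact hsα _
    _ = (c * a * c⁻¹ : elemCentralizer x) := by rw [mul_zpow_conj, zpow_zero, mul_one]

theorem relIndex_innerAut_centralizer_ne_zero
    (h : (innerAut (joinElem P)).relIndex (F.aut (joinElem P)) ≠ 0) :
    (innerAut P).relIndex ((F.centralizer x).aut P) ≠ 0 := by
  rw [relIndex_aut_centralizer]
  refine ne_zero_of_dvd_ne_zero ?_ (Subgroup.index_dvd_of_le comap_innerAut_joinElem_le)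
  rw [Subgroup.index_comap]
  exact fun h0 => h (Subgroup.relIndex_eq_zero_of_le_right range_fst_restrictingAut_le h0)

theorem comap_autBy_joinElem_le {Q : Subgroup S} {R : Subgroup (elemCentralizer x)} {g ρ : S → S}
    (hg : F.IsIso g (joinElem P) Q) (hρ : F.IsMor ρ (elemCentralizer (g x))) (hρx : ρ (g x) = x)
    {e : joinElem P ≃* Q} (he : ∀ a, (e a : S) = g a)
    {e' : P ≃* R} (he' : ∀ a, ((e' a : elemCentralizer x) : S) = ρ (g a)) :
    (autBy Q).comap ((MulAut.congr e).toMonoidHom.comp (restrictingAut.fst F P)) ≤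
      ((autBy R).comap (MulAut.congr e').toMonoidHom).comap (restrictingAut.snd F P) := by
  rintro ⟨⟨α, β⟩, _, hαx, hαβ⟩ hα
  obtain ⟨t, ht⟩ := mem_autBy_iff.1 (show MulAut.congr e α ∈ autBy Q from hα)
  have htα : ∀ a, g (α a) = t * g a * t⁻¹ := fun a => by
    rw [← he, ← he, ← ht]
    exact congrArg (fun b => (e (α b) : S)) (e.symm_apply_apply a).symm
  have htC : t ∈ elemCentralizer (g x) := mem_elemCentralizer_iff_conj_eq.2 <| by
    simpa only [hαx] using (htα ⟨x, elem_mem_joinElem P⟩).symm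
  have hρt : ρ t ∈ elemCentralizer x := by
    simpa only [hρx] using hρ.map_mem_elemCentralizer (mem_elemCentralizer_self _) htC htC
  refine mem_autBy_iff.2 ⟨⟨ρ t, hρt⟩, fun b => Subtype.ext ?_⟩
  obtain ⟨a, rfl⟩ := e'.surjective b
  change ((e' (β (e'.symm (e' a))) : elemCentralizer x) : S) =
    ρ t * (e' a : elemCentralizer x) * (ρ t)⁻¹
  have hga := hg.le_elemCentralizer (hg.map_mem (coe_mem_joinElem a))
  have hβ : g (β a : elemCentralizer x) = t * g a * t⁻¹ := by
    simpa only [hαβ] using htα ⟨a, coe_mem_joinElem a⟩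
  rw [e'.symm_apply_apply, he', he', hβ, hρ.map_conj htC hga]

theorem IsSaturated.exists_isIso_hasSylowAut_centralizer [Fact p.Prime] (hS : IsPToral p S)
    (hF : F.IsSaturated p) (hx : F.IsReceptive x) (P : Subgroup (elemCentralizer x)) :
    ∃ f R, (F.centralizer x).IsIso f P R ∧ (F.centralizer x).FullyCentralized p R ∧
      (F.centralizer x).HasSylowAut p R := by
  obtain ⟨θ, Q, hθ, hQ⟩ := exists_fullyNormalized hS F (joinElem P)
  obtain ⟨hcent, hsylow⟩ := (sylowAxiom_iff hS.isPGroup).1 hF.sylowAxiom Q hQ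
  -- After twisting `θ` by an automorphism of `Q`, the image of `Aut_{C_F(x)}(P)` in `Aut_F(Q)`
  -- meets `Aut_S(Q)` in a subgroup of index prime to `p`.
  obtain ⟨g, e, hg, he, hindex⟩ :=
    hsylow.exists_isIso_not_dvd_index hθ range_fst_restrictingAut_le
  have hgx : g x ∈ Q := hg.map_mem (elem_mem_joinElem P)
  obtain ⟨k, hk, hkg, -⟩ := hg.exists_symm
  obtain ⟨ρ, hρ, hρx⟩ := hx (g x) <| by
    simpa only [hkg x (elem_mem_joinElem P)] using hk.isMor.isConjugateElement hgx
  obtain ⟨T, hT⟩ := (hρ.mono hg.le_elemCentralizer).exists_isIso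
  obtain ⟨f, R, hf, rfl, hfg⟩ := (hg.trans hT).exists_isIso_centralizer hρx
  have hcentT := hρ.toralOrder_centralizer_le hS hg.le_elemCentralizer
    (centralizer_le_elemCentralizer hgx) hT
  refine ⟨f, R, hf, .of_joinElem hS (hcent.of_isIso hT hcentT), ?_⟩
  obtain ⟨e', -, -, he'⟩ := hf.exists_mulEquiv
  rw [HasSylowAut, relIndex_aut_congr e' hf he', relIndex_aut_congr e' hf he',
    comap_innerAut_congr, relIndex_aut_centralizer ((autBy R).comap _)]
  constructor
  · apply relIndex_innerAut_centralizer_ne_zero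
    rw [← comap_innerAut_congr e, ← relIndex_aut_congr e hg he]
    exact hsylow.1
  · exact fun hd => hindex <| hd.trans <| Subgroup.index_dvd_of_le <|
      comap_autBy_joinElem_le hg hρ hρx he fun a => by rw [he', hfg a a.2]

theorem IsSaturated.centralizer [Fact p.Prime] (hS : IsPToral p S) (hF : F.IsSaturated p)
    (hx : F.IsReceptive x) : (F.centralizer x).IsSaturated p := by
  have hC := hS.subgroup (elemCentralizer x)
  have hext := hF.extensionAxiom.centralizer hS hx
  refine ⟨(sylowAxiom_iff hC.isPGroup).2 fun P hP => ?_, hext, hF.continuityAxiom.centralizer x⟩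
  obtain ⟨f, R, hf, hcent, hsylow⟩ := hF.exists_isIso_hasSylowAut_centralizer hS hx P
  exact hP.fullyCentralized_and_hasSylowAut hC hext hf hcent hsylow

theorem IsSaturated.isLocallySaturated [Fact p.Prime] (hS : IsPToral p S)
    (hF : F.IsSaturated p) : F.IsLocallySaturated p := fun x _ => by
  obtain ⟨f, Q, hf, hQ⟩ := exists_fullyNormalized hS F (Subgroup.zpowers x)
  obtain rfl : Q = Subgroup.zpowers (f x) :=
    SetLike.coe_injective (hf.image_eq.symm.trans hf.isMor.isIso_zpowers.image_eq)
  have hfx : F.IsReceptive (f x) :=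
    hF.extensionAxiom.isReceptive ((sylowAxiom_iff hS.isPGroup).1 hF.sylowAxiom _ hQ).1
  exact ⟨f x, hf.isMor.isConjugateElement (Subgroup.mem_zpowers x), hfx, hF.centralizer hS hfx⟩

theorem isSaturated_iff [Fact p.Prime] (hS : IsPToral p S) :
    F.IsSaturated p ↔ F.ContinuityAxiom ∧ F.IsLocallySaturated p :=
  ⟨fun hF => ⟨hF.continuityAxiom, hF.isLocallySaturated hS⟩,
    fun ⟨hcont, hF⟩ => ⟨hF.sylowAxiom hS, hF.extensionAxiom hS, hcont⟩⟩

theorem isReceptive_iff {y : S} : F.IsReceptive y ↔ ∀ x, F.IsConjugateElement x y →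
    ∃ ρ ∈ F.Hom (elemCentralizer x) (elemCentralizer y),
      (ρ ⟨x, mem_elemCentralizer_self x⟩ : S) = y := by
  refine forall₂_congr fun x _ => ⟨?_, fun ⟨ρ, hρ, hρx⟩ => ?_⟩
  · rintro ⟨ρ, hρ, rfl⟩
    exact ⟨homOfMulOn _ _ ρ (fun a ha b hb => hρ.map_mul ha hb)
      fun a ha => hρ.map_mem_elemCentralizer (mem_elemCentralizer_self x) ha ha,
      hρ.mem_hom _ fun _ => rfl, rfl⟩
  · obtain ⟨f, hf, hfρ⟩ := exists_isMor_of_mem_hom hρ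
    exact ⟨f, hf, (hfρ ⟨x, mem_elemCentralizer_self x⟩).trans hρx⟩

theorem IsConjugateElement.orderOf_eq {y : S} (h : F.IsConjugateElement x y) :
    orderOf x = orderOf y := by
  obtain ⟨φ, hφ, hφx⟩ := h
  rw [← congrArg orderOf hφx, Subgroup.orderOf_coe, orderOf_injective φ (F.injective_of_mem hφ),
    Subgroup.orderOf_mk]

end Saturated

end FusionSystem

theorem mainTheorem2 (p : ℕ) [Fact p.Prime] {S : Type*} [Group S] (hS : IsDiscretePToral p S)
    (F : FusionSystem S) :
    F.IsSaturated p ↔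
      F.ContinuityAxiom ∧
      ∃ X : Set S, (∀ x ∈ X, orderOf x = p) ∧
        (∀ x : S, orderOf x = p → ∃ y ∈ X, F.IsConjugateElement x y) ∧
        (∀ x y : S, F.IsConjugateElement x y → y ∈ X →
          ∃ ρ ∈ F.Hom (elemCentralizer x) (elemCentralizer y),
            (ρ ⟨x, mem_elemCentralizer_self x⟩ : S) = y) ∧
        ∀ x ∈ X, (F.centralizer x).IsSaturated p := by
  rw [FusionSystem.isSaturated_iff (.of_isDiscretePToral hS)]
  refine and_congr_right fun _ => ⟨fun hF => ?_, fun ⟨X, _, hconj, hrec, hsat⟩ x hx => ?_⟩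
  · refine ⟨{y | orderOf y = p ∧ F.IsReceptive y ∧ (F.centralizer y).IsSaturated p},
      fun y hy => hy.1, fun x hx => ?_,
      fun x y hxy hy => FusionSystem.isReceptive_iff.1 hy.2.1 x hxy, fun y hy => hy.2.2⟩
    obtain ⟨y, hxy, hy⟩ := hF x hx
    exact ⟨y, ⟨hxy.orderOf_eq ▸ hx, hy⟩, hxy⟩
  · obtain ⟨y, hy, hxy⟩ := hconj x hx
    exact ⟨y, hxy, FusionSystem.isReceptive_iff.2 fun z hz => hrec z y hz hy, hsat y hy⟩
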